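/- **Theorem (Convex reduction).** Let $I, J\ge 1$ and $M,H,K\in\mathbb N$; let $\|\cdot\|$ be an arbitrary norm on $\mathbb{R}^M$, with dual norm $\|v\|_* := \sup_{\|u\|\le 1}\langle v,u\rangle$, where $\langle u,v\rangle=u^{\mathsf T}v$. Let $\mathbb X\subseteq\mathbb R^K$, let $\Xi\subseteq\mathbb{R}^M$ be closed and convex, and let $\ell_1,\dots,\ell_J:\mathbb R^K\times\mathbb{R}^M\to[-\infty,\infty]$ be such that for every $x\in\mathbb X$ and every $j$ the function $\xi\mapsto-\ell_j(x,\xi)$ is proper (never $-\infty$ and not identically $+\infty$), convex and lower semicontinuous on $\mathbb{R}^M$, and $\ell_j(x,\cdot)$ is not identically $-\infty$ on $\Xi$. Put $\ell:=\max_{1\le j\le J}\ell_j$. Let $t_1,\dots,t_H\ge 0$ with $\sum_{h=1}^H t_h=1$ (the trust weights), let $\hat\xi_h^{(i)}\in\mathbb{R}^M$ ($1\le h\le H$, $1\le i\le I$) be given points, and let $$\hat{\mathbb P}_{HI}:=\sum_{h=1}^H\frac{t_h}{I}\sum_{i=1}^I\delta_{\hat\xi_h^{(i)}} .$$ For $\epsilon\ge0$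 let $\mathbb B_\epsilon(\hat{\mathbb P}_{HI})$ be the set of Borel probability measures $\mathbb Q$ supported on $\Xi$ with $\mathbb{E}^{\mathbb Q}[\|\xi\|]<\infty$ and $d_W(\hat{\mathbb P}_{HI},\mathbb Q)\le\epsilon$, where $$d_W(\hat{\mathbb P}_{HI},\mathbb Q):=\inf_\Pi\int\|\xi-\xi'\|\,\Pi(d\xi,d\xi')$$ and $\Pi$ ranges over the joint distributions of $(\xi,\xi')$ on $\mathbb R^M\times\mathbb R^M$ with marginals $\mathbb Q$ and $\hat{\mathbb P}_{HI}$, respectively. For a function $f:\mathbb{R}^M\to[-\infty,\infty]$ write $f^*(v):=\sup_{u\in\operatorname{dom} f}\{\langle v,u\rangle-f(u)\}$ with $\operatorname{dom} f=\{f<+\infty\}$; let $\sigma_\Xi(u):=\sup_{\xi\in\Xi}\langle u,\xi\rangle$; and let $[-\ell_j]^*$ be the conjugate of $\xi\mapsto-\ell_j(x,\xi)$. Then for every $x\in\mathbb X$ and every $\epsilon\ge 0$ the worst-case expectation $$\sup_{\mathbb Q\in\mathbb B_\epsilon(\hat{\mathbb P}_{HI})}\mathbb{E}^{\mathbb Q}[\ell(x,\xi)]$$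 (as an extended real number, with $\mathbb E^{\mathbb Q}[\ell]=\mathbb E^{\mathbb Q}[\ell^+]-\mathbb E^{\mathbb Q}[\ell^-]$) equals the optimal value of the program $$\begin{aligned}\inf_{\lambda,\,s_{hi},\,z_{hij},\,\nu_{hij}}\quad&\lambda\epsilon+\sum_{h=1}^H\sum_{i=1}^I\frac{t_h}{I}\,s_{hi}\\ \text{s.t.}\quad&[-\ell_j]^*(z_{hij}-\nu_{hij})+\sigma_\Xi(\nu_{hij})-\langle z_{hij},\hat\xi_h^{(i)}\rangle\le s_{hi}\quad\forall h,i,j,\\&\|z_{hij}\|_*\le\lambda\quad\forall h,i,j,\end{aligned}$$ over $\lambda,s_{hi}\in\mathbb R$ and $z_{hij},\nu_{hij}\in\mathbb R^M$. This program is a finite-dimensional convex program: its feasible set and its objective are convex. -/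

import Mathlib

open scoped BigOperators ENNReal

noncomputable section

namespace MRDRO

open MeasureTheory

/-! ### Convex analysis for extended-real-valued functions -/

/-- A function is proper if it never takes the value `-∞` and is not identically `+∞`. -/
def IsProper {M : ℕ} (f : (Fin M → ℝ) → EReal) : Prop :=
  (∀ u, f u ≠ ⊥) ∧ ∃ u, f u ≠ ⊤

/-- Convexity of an extended-real-valued function: its epigraph is a convex set. -/
def IsConvexFun {M : ℕ} (f : (Fin M → ℝ) → EReal) : Prop :=
  Convex ℝ {p : (Fin M → ℝ) × ℝ | f p.1 ≤ (p.2 : EReal)}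

/-- The effective domain `{u | f u < +∞}`. -/
def effDom {M : ℕ} (f : (Fin M → ℝ) → EReal) : Set (Fin M → ℝ) :=
  {u | f u < ⊤}

/-- The conjugate `f^*(v) = sup_{u ∈ dom f} ⟨v, u⟩ - f u`. -/
def conjugate {M : ℕ} (f : (Fin M → ℝ) → EReal) (v : Fin M → ℝ) : EReal :=
  ⨆ u ∈ effDom f, (((v ⬝ᵥ u : ℝ) : EReal) - f u)

/-- The support function `σ_Ξ(u) = sup_{ξ ∈ Ξ} ⟨u, ξ⟩`. -/
def supportFun {M : ℕ} (Ξ : Set (Fin M → ℝ)) (u : Fin M → ℝ) : EReal :=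
  ⨆ ξ ∈ Ξ, ((u ⬝ᵥ ξ : ℝ) : EReal)

/-- The dual norm `‖v‖_* = sup_{‖u‖ ≤ 1} ⟨v, u⟩` of the norm `N`. -/
def dualNorm {M : ℕ} (N : Seminorm ℝ (Fin M → ℝ)) (v : Fin M → ℝ) : EReal :=
  ⨆ u ∈ {u : Fin M → ℝ | N u ≤ 1}, ((v ⬝ᵥ u : ℝ) : EReal)

/-! ### Distributions and the Wasserstein ball -/

/-- The expectation `E^Q[g] = ∫ g⁺ dQ - ∫ g⁻ dQ`, with values in the extended reals. -/
def expect {M : ℕ} (Q : Measure (Fin M → ℝ)) (g : (Fin M → ℝ) → EReal) : EReal :=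
  ((∫⁻ ξ, (g ξ).toENNReal ∂Q : ℝ≥0∞) : EReal) -
    ((∫⁻ ξ, (-(g ξ)).toENNReal ∂Q : ℝ≥0∞) : EReal)

/-- The trust-weighted discrete distribution, which puts mass `t h / I` on each `ξhat h i`. -/
def trustDist {M H I : ℕ} (t : Fin H → ℝ) (ξhat : Fin H → Fin I → Fin M → ℝ) :
    Measure (Fin M → ℝ) :=
  ∑ h, ENNReal.ofReal (t h / (I : ℝ)) • ∑ i, Measure.dirac (ξhat h i)

/-- `γ` is a joint distribution of `(ξ, ξ')` with marginals `Q` (of `ξ`) and `P` (of `ξ'`). -/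
def IsCoupling {M : ℕ} (Q P : Measure (Fin M → ℝ))
    (γ : Measure ((Fin M → ℝ) × (Fin M → ℝ))) : Prop :=
  γ.map Prod.fst = Q ∧ γ.map Prod.snd = P

/-- The 1-Wasserstein distance with respect to the norm `N`. -/
def wassersteinDist {M : ℕ} (N : Seminorm ℝ (Fin M → ℝ)) (P Q : Measure (Fin M → ℝ)) : ℝ≥0∞ :=
  ⨅ γ ∈ {γ : Measure ((Fin M → ℝ) × (Fin M → ℝ)) | IsCoupling Q P γ},
    ∫⁻ p, ENNReal.ofReal (N (p.1 - p.2)) ∂γ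

/-- The Wasserstein ball of radius `ε` around `P`: the probability distributions supported on `Ξ`,
with finite first moment, at Wasserstein distance at most `ε` from `P`. -/
def wassersteinBall {M : ℕ} (N : Seminorm ℝ (Fin M → ℝ)) (Ξ : Set (Fin M → ℝ))
    (P : Measure (Fin M → ℝ)) (ε : ℝ) : Set (Measure (Fin M → ℝ)) :=
  {Q | IsProbabilityMeasure Q ∧ Q Ξᶜ = 0 ∧ ∫⁻ ξ, ENNReal.ofReal (N ξ) ∂Q < ⊤ ∧
    wassersteinDist N P Q ≤ ENNReal.ofReal ε}

/-- The worst-case expectation of the loss `g` over the Wasserstein ball. -/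
def worstCase {M : ℕ} (N : Seminorm ℝ (Fin M → ℝ)) (Ξ : Set (Fin M → ℝ))
    (P : Measure (Fin M → ℝ)) (ε : ℝ) (g : (Fin M → ℝ) → EReal) : EReal :=
  ⨆ Q ∈ wassersteinBall N Ξ P ε, expect Q g

/-! ### The finite convex program -/

/-- The decision variables `(λ, s, z, ν)`, of finite dimension `1 + HI + HIJM + HIJM`. -/
abbrev DecVar (M H I J : ℕ) : Type :=
  ℝ × (Fin H → Fin I → ℝ) × (Fin H → Fin I → Fin J → Fin M → ℝ) ×
    (Fin H → Fin I → Fin J → Fin M → ℝ)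

/-- The objective `λ ε + ∑ h, ∑ i, (t h / I) s h i`. -/
def objective {M H I J : ℕ} (t : Fin H → ℝ) (ε : ℝ) : DecVar M H I J → ℝ :=
  fun (lam, s, _, _) => lam * ε + ∑ h, ∑ i, t h / (I : ℝ) * s h i

/-- The feasible set: `[-ℓ_j]^*(z - ν) + σ_Ξ(ν) - ⟨z, ξhat⟩ ≤ s` and `‖z‖_* ≤ λ`, for all
`h`, `i`, `j`. -/
def feasible {M H I J : ℕ} (N : Seminorm ℝ (Fin M → ℝ)) (Ξ : Set (Fin M → ℝ))
    (l : Fin J → (Fin M → ℝ) → EReal) (ξhat : Fin H → Fin I → Fin M → ℝ) :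
    Set (DecVar M H I J) :=
  {(lam, s, z, ν) |
    (∀ h i j, conjugate (fun ξ => -(l j ξ)) (z h i j - ν h i j) + supportFun Ξ (ν h i j)
      - ((z h i j ⬝ᵥ ξhat h i : ℝ) : EReal) ≤ (s h i : EReal)) ∧
    (∀ h i j, dualNorm N (z h i j) ≤ (lam : EReal))}

/-- The optimal value (infimum) of the program. -/
def optValue {M H I J : ℕ} (N : Seminorm ℝ (Fin M → ℝ)) (Ξ : Set (Fin M → ℝ))
    (l : Fin J → (Fin M → ℝ) → EReal) (t : Fin H → ℝ) (ξhat : Fin H → Fin I → Fin M → ℝ)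
    (ε : ℝ) : EReal :=
  ⨅ d ∈ feasible N Ξ l ξhat, ((objective t ε d : ℝ) : EReal)

end MRDRO

end

namespace MRDRO

open MeasureTheory

/-! ### Norms and linear functionals on `ℝ^M` -/

/-! Put one multiplier λ ≥ 0 on the transport budget. There are finitely many atoms c_r, with
weights w_r, so the penalised problem splits: each atom contributes w_r times the supremum over Ξ of
ℓ(ξ) - λ‖ξ - c_r‖. The program is the infimum over λ of λε plus these suprema, each one dualised
again, piece by piece.

Weak duality (`expect_le_of_mem_wassersteinBall`): feasibility gives ℓ(ξ) ≤ s_r + λ‖ξ - c_r‖ on Ξ,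
and this is integrated against a nearly optimal coupling.

Strong duality rests on two facts. `exists_dual_certificate` is Fenchel duality for the sum of -ℓ_j,
the indicator of Ξ and λ‖· - c_r‖. The domains are only known to meet, so exact multipliers may not
exist; an arbitrarily small increase of λ and s supplies them, and the infimum does not notice.
`exists_mixture_of_lagrangian` eliminates λ: if for every λ some choice of one point per atom has
Lagrangian value above v, then a mixture of two choices respects the budget and has value at least
v. Two suffice because (cost, value) is a point of a plane. When no choice costs less than ε, for
instance when ε = 0, Slater's condition fails, and compactness with linear growth of ℓ replaces it.
Such a mixture is a discrete measure in the ball, which sends each atom to at most two places. -/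

theorem seminorm_continuous {M : ℕ} (N : Seminorm ℝ (Fin M → ℝ)) : Continuous N :=
  continuousOn_univ.1 (N.convexOn.continuousOn isOpen_univ)

/-- Equivalence of norms: `N` has a positive minimum on the compact sup-norm unit sphere. That
sphere is empty when `M = 0`, where any constant works. -/
theorem exists_norm_le_mul_seminorm {M : ℕ} (N : Seminorm ℝ (Fin M → ℝ))
    (hN : ∀ u, N u = 0 → u = 0) : ∃ C : ℝ, 0 < C ∧ ∀ u, ‖u‖ ≤ C * N u := by
  have hcpt : IsCompact (Metric.sphere (0 : Fin M → ℝ) 1) := isCompact_sphere 0 1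
  rcases (Metric.sphere (0 : Fin M → ℝ) 1).eq_empty_or_nonempty with hS | hS
  · refine ⟨1, one_pos, fun u => ?_⟩
    by_cases hu : u = 0
    · simp [hu]
    · exfalso
      have : (‖u‖⁻¹ • u) ∈ Metric.sphere (0 : Fin M → ℝ) 1 := by
        simp [norm_smul, norm_ne_zero_iff.2 hu]
      simp [hS] at this
  · obtain ⟨v, hv, hmin⟩ := hcpt.exists_isMinOn hS (seminorm_continuous N).continuousOn
    have hv1 : ‖v‖ = 1 := by simpa using hv
    have hpos : 0 < N v := by
      refine lt_of_le_of_ne (apply_nonneg N v) fun h => ?_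
      have := hN v h.symm
      simp [this] at hv1
    refine ⟨(N v)⁻¹, inv_pos.2 hpos, fun u => ?_⟩
    by_cases hu : u = 0
    · simp [hu]
    · have hmem : (‖u‖⁻¹ • u) ∈ Metric.sphere (0 : Fin M → ℝ) 1 := by
        simp [norm_smul, norm_ne_zero_iff.2 hu]
      have h1 : N v ≤ N (‖u‖⁻¹ • u) := hmin hmem
      have hpu : 0 < ‖u‖ := norm_pos_iff.2 hu
      rw [map_smul_eq_mul, norm_inv, norm_norm] at h1
      rw [inv_mul_eq_div, le_div_iff₀ hpos]
      calc ‖u‖ * N v ≤ ‖u‖ * (‖u‖⁻¹ * N u) := by gcongr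
        _ = N u := by field_simp

theorem exists_isMinOn_seminorm_sub {M : ℕ} (N : Seminorm ℝ (Fin M → ℝ))
    (hN : ∀ u, N u = 0 → u = 0) (c : Fin M → ℝ) {Z : Set (Fin M → ℝ)} (hZ : IsClosed Z)
    (hne : Z.Nonempty) : ∃ x ∈ Z, ∀ y ∈ Z, N (x - c) ≤ N (y - c) := by
  obtain ⟨C, hC, hle⟩ := exists_norm_le_mul_seminorm N hN
  obtain ⟨z, hz⟩ := hne
  have hcont : Continuous fun x => N (x - c) :=
    (seminorm_continuous N).comp (continuous_id.sub continuous_const)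
  have hcpt : IsCompact (Z ∩ Metric.closedBall c (C * N (z - c))) :=
    (isCompact_closedBall _ _).inter_left hZ
  have hzmem : z ∈ Z ∩ Metric.closedBall c (C * N (z - c)) :=
    ⟨hz, by simpa [dist_eq_norm] using hle (z - c)⟩
  obtain ⟨x, hx, hmin⟩ := hcpt.exists_isMinOn ⟨z, hzmem⟩ hcont.continuousOn
  refine ⟨x, hx.1, fun y hy => ?_⟩
  by_cases h : N (y - c) ≤ N (z - c)
  · refine hmin (show y ∈ _ from ⟨hy, ?_⟩)
    rw [Metric.mem_closedBall, dist_eq_norm]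
    exact (hle _).trans (by gcongr)
  · exact (hmin hzmem).trans (not_le.1 h).le

theorem exists_dotProduct_eq {M : ℕ} (φ : (Fin M → ℝ) →ₗ[ℝ] ℝ) :
    ∃ α : Fin M → ℝ, ∀ a, φ a = α ⬝ᵥ a := by
  refine ⟨fun i => φ (Pi.single i 1), fun a => ?_⟩
  rw [LinearMap.pi_apply_eq_sum_univ φ a]
  simp only [dotProduct, smul_eq_mul]
  refine Finset.sum_congr rfl fun i _ => ?_
  rw [mul_comm]
  congr 2
  ext j
  simp [Pi.single_apply, eq_comm]

/-- Replacing `u` by `n • u` multiplies a violation by `n` but leaves `C` fixed. -/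
theorem dotProduct_le_of_bounded {M : ℕ} (N : Seminorm ℝ (Fin M → ℝ)) {z : Fin M → ℝ}
    {lam C : ℝ} (h : ∀ u, z ⬝ᵥ u ≤ lam * N u + C) (u : Fin M → ℝ) : z ⬝ᵥ u ≤ lam * N u := by
  by_contra! hlt
  obtain ⟨n, hn⟩ := exists_nat_gt (C / (z ⬝ᵥ u - lam * N u))
  rw [div_lt_iff₀ (by linarith)] at hn
  have := h ((n : ℝ) • u)
  rw [map_smul_eq_mul, dotProduct_smul, smul_eq_mul,
    Real.norm_of_nonneg (Nat.cast_nonneg n)] at this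
  nlinarith

/-- Homogeneity, together with the test point `u = 0` for the sign of `lam`. The clause `0 ≤ lam`
carries information only when `M = 0`. -/
theorem dualNorm_le_iff {M : ℕ} (N : Seminorm ℝ (Fin M → ℝ)) (hN : ∀ u, N u = 0 → u = 0)
    (z : Fin M → ℝ) (lam : ℝ) :
    dualNorm N z ≤ (lam : EReal) ↔ 0 ≤ lam ∧ ∀ u, z ⬝ᵥ u ≤ lam * N u := by
  have h0 : dualNorm N z ≤ (lam : EReal) ↔ ∀ u, N u ≤ 1 → z ⬝ᵥ u ≤ lam := by
    simp only [dualNorm, Set.mem_ofPred_eq, iSup_le_iff, EReal.coe_le_coe_iff]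
  rw [h0]
  constructor
  · refine fun h => ⟨by simpa using h 0 (by simp), fun u => ?_⟩
    by_cases hu : N u = 0
    · simp [hN u hu]
    · have hpos : 0 < N u := lt_of_le_of_ne (apply_nonneg N u) (Ne.symm hu)
      have := h ((N u)⁻¹ • u) (by
        rw [map_smul_eq_mul, norm_inv, Real.norm_of_nonneg hpos.le, inv_mul_cancel₀ hu])
      rwa [dotProduct_smul, smul_eq_mul, inv_mul_eq_div, div_le_iff₀ hpos] at this
  · rintro ⟨hlam, h⟩ u hu
    exact (h u).trans (mul_le_of_le_one_right hlam hu)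

/-! ### Properness, conjugates and support functions -/

/-- The constraint of the program, as a family of affine inequalities. -/
theorem conjugate_add_supportFun_sub_le_iff {M : ℕ} {f : (Fin M → ℝ) → EReal}
    (hf : IsProper f) {Ξ : Set (Fin M → ℝ)} (hΞ : Ξ.Nonempty) (v n : Fin M → ℝ) (c s : ℝ) :
    conjugate f v + supportFun Ξ n - (c : EReal) ≤ (s : EReal) ↔
      ∀ u (ρ : ℝ), f u ≤ ρ → ∀ ξ ∈ Ξ, v ⬝ᵥ u - ρ + n ⬝ᵥ ξ - c ≤ s := by
  constructor
  · intro h u ρ hu ξ hξ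
    have hdom : u ∈ effDom f := lt_of_le_of_lt hu (EReal.coe_lt_top ρ)
    have h1 : ((v ⬝ᵥ u - ρ : ℝ) : EReal) ≤ conjugate f v := by
      refine le_trans ?_ (le_iSup₂ (f := fun u _ => ((v ⬝ᵥ u : ℝ) : EReal) - f u) u hdom)
      rw [EReal.coe_sub]
      exact EReal.sub_le_sub le_rfl hu
    have h2 : ((n ⬝ᵥ ξ : ℝ) : EReal) ≤ supportFun Ξ n :=
      le_iSup₂ (f := fun ξ _ => ((n ⬝ᵥ ξ : ℝ) : EReal)) ξ hξ
    have h3 := (EReal.sub_le_sub (add_le_add h1 h2) (le_refl (c : EReal))).trans h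
    exact_mod_cast h3
  · intro h
    obtain ⟨ξ₀, hξ₀⟩ := hΞ
    obtain ⟨u₀, hu₀⟩ := hf.2
    have hreal : ∀ u, f u ≠ ⊤ → ((f u).toReal : EReal) = f u := fun u hu =>
      EReal.coe_toReal hu (hf.1 u)
    -- Finiteness must precede arithmetic, because `⊤ + ⊥` in `EReal` is a convention. A point where
    -- `f` is finite bounds the support function above and a point of `Ξ` bounds it below; only then
    -- can it be moved across the inequality.
    have hσle : ∀ u, f u ≠ ⊤ →
        supportFun Ξ n ≤ ((s + c - (v ⬝ᵥ u - (f u).toReal) : ℝ) : EReal) := by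
      intro u hu
      refine iSup₂_le fun ξ hξ => EReal.coe_le_coe_iff.2 ?_
      linarith [h u (f u).toReal (hreal u hu).ge ξ hξ]
    have hσbot : supportFun Ξ n ≠ ⊥ := fun hb => by
      have := le_iSup₂ (f := fun ξ (_ : ξ ∈ Ξ) => ((n ⬝ᵥ ξ : ℝ) : EReal)) ξ₀ hξ₀
      rw [show (⨆ ξ ∈ Ξ, ((n ⬝ᵥ ξ : ℝ) : EReal)) = ⊥ from hb] at this
      exact EReal.coe_ne_bot _ (le_bot_iff.1 this)
    have hσtop : supportFun Ξ n ≠ ⊤ := ne_top_of_le_ne_top (EReal.coe_ne_top _) (hσle u₀ hu₀)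
    obtain ⟨b, hb⟩ : ∃ b : ℝ, supportFun Ξ n = b :=
      ⟨_, (EReal.coe_toReal hσtop hσbot).symm⟩
    have hconj : conjugate f v ≤ ((s + c - b : ℝ) : EReal) := by
      refine iSup₂_le fun u hu => ?_
      have hu' : f u ≠ ⊤ := ne_of_lt hu
      have := hσle u hu'
      rw [hb, EReal.coe_le_coe_iff] at this
      rw [← hreal u hu', ← EReal.coe_sub, EReal.coe_le_coe_iff]
      linarith
    rw [hb]
    refine (EReal.sub_le_sub (add_le_add hconj le_rfl) le_rfl).trans ?_
    rw [← EReal.coe_add, ← EReal.coe_sub, EReal.coe_le_coe_iff]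
    linarith

theorem isClosed_real_epigraph {M : ℕ} {f : (Fin M → ℝ) → EReal}
    (hlsc : LowerSemicontinuous f) :
    IsClosed {p : (Fin M → ℝ) × ℝ | f p.1 ≤ (p.2 : EReal)} :=
  hlsc.isClosed_epigraph.preimage
    (continuous_fst.prodMk (continuous_coe_real_ereal.comp continuous_snd))

/-- A hyperplane separating the closed epigraph from a point directly below one of its points is not
vertical, so it is the graph of an affine minorant. For the loss this means at most linear growth.
-/
theorem exists_affine_lower_bound {M : ℕ} (N : Seminorm ℝ (Fin M → ℝ))
    (hN : ∀ u, N u = 0 → u = 0) {f : (Fin M → ℝ) → EReal} (hf : IsProper f)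
    (hconv : IsConvexFun f) (hlsc : LowerSemicontinuous f) :
    ∃ A B : ℝ, 0 ≤ B ∧ ∀ u, ((-A - B * N u : ℝ) : EReal) ≤ f u := by
  obtain ⟨u₀, hu₀⟩ := hf.2
  obtain ⟨r₀, hr₀⟩ : ∃ r : ℝ, f u₀ = r := ⟨_, (EReal.coe_toReal hu₀ (hf.1 u₀)).symm⟩
  have hnot : (u₀, r₀ - 1) ∉ {p : (Fin M → ℝ) × ℝ | f p.1 ≤ (p.2 : EReal)} := by
    rw [Set.mem_ofPred_eq, hr₀, EReal.coe_le_coe_iff]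
    simp
  obtain ⟨φ, k, hφ, hk⟩ :=
    geometric_hahn_banach_point_closed hconv (isClosed_real_epigraph hlsc) hnot
  obtain ⟨α, hα⟩ := exists_dotProduct_eq
    ((φ : ((Fin M → ℝ) × ℝ) →ₗ[ℝ] ℝ).comp (LinearMap.inl ℝ (Fin M → ℝ) ℝ))
  set γ := φ (0, 1) with hγ
  have hsplit : ∀ u r, φ (u, r) = α ⬝ᵥ u + r * γ := by
    intro u r
    have h1 : φ (u, 0) = α ⬝ᵥ u := hα u
    have h2 : φ (0, r) = r * γ := by
      rw [hγ, ← smul_eq_mul, ← map_smul]; simp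
    rw [← h1, ← h2, ← map_add]; simp
  have hlow : ∀ u (r : ℝ), f u ≤ r → k < α ⬝ᵥ u + r * γ := fun u r hu => by
    rw [← hsplit]; exact hk _ hu
  have hγpos : 0 < γ := by
    have h1 := hlow u₀ r₀ hr₀.le
    rw [hsplit] at hφ
    linarith
  obtain ⟨C, hC, hCle⟩ := exists_norm_le_mul_seminorm N hN
  have hdot : ∀ u, α ⬝ᵥ u ≤ (∑ i, |α i|) * C * N u := fun u => by
    calc α ⬝ᵥ u ≤ ∑ i, |α i| * ‖u‖ := Finset.sum_le_sum fun i _ =>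
          (le_abs_self _).trans (by rw [abs_mul]; gcongr; exact norm_le_pi_norm u i)
      _ = (∑ i, |α i|) * ‖u‖ := (Finset.sum_mul _ _ _).symm
      _ ≤ (∑ i, |α i|) * (C * N u) := by
          gcongr
          exact hCle u
      _ = _ := by ring
  refine ⟨-k / γ, (∑ i, |α i|) * C / γ, by positivity, fun u => ?_⟩
  by_cases hu : f u = ⊤
  · simp [hu]
  · rw [← EReal.coe_toReal hu (hf.1 u), EReal.coe_le_coe_iff]
    have h1 := hlow u (f u).toReal (EReal.coe_toReal hu (hf.1 u)).ge
    have h2 := hdot u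
    have : -(-k / γ) - (∑ i, |α i|) * C / γ * N u = (k - (∑ i, |α i|) * C * N u) / γ := by
      field_simp
    rw [this, div_le_iff₀ hγpos]
    linarith

/-- The perturbation set whose closure avoids `(0, 0, τ)` as soon as `τ` lies strictly below the
infimum of `f + lam * N (· - c)` over `Ξ`, provided that there is some slack in `lam`. -/
theorem not_mem_closure_perturbation {M : ℕ} (N : Seminorm ℝ (Fin M → ℝ))
    (hN : ∀ u, N u = 0 → u = 0) {f : (Fin M → ℝ) → EReal} (hf : ∀ u, f u ≠ ⊥)
    (hconv : IsConvexFun f) (hlsc : LowerSemicontinuous f) {Ξ : Set (Fin M → ℝ)}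
    (hΞ_convex : Convex ℝ Ξ) (hΞ_closed : IsClosed Ξ) {c ξ₀ : Fin M → ℝ} (hξ₀ : ξ₀ ∈ Ξ)
    (hfξ₀ : f ξ₀ ≠ ⊤) {s lam lam' δ : ℝ} (hlam : 0 ≤ lam) (hlt : lam < lam') (hδ : 0 < δ)
    (h : ∀ ξ ∈ Ξ, ∀ ρ : ℝ, f ξ ≤ ρ → -s ≤ ρ + lam * N (ξ - c)) :
    ((0, 0, -s - δ) : (Fin M → ℝ) × (Fin M → ℝ) × ℝ) ∉
      closure {q : (Fin M → ℝ) × (Fin M → ℝ) × ℝ | ∃ u, ∃ ξ ∈ Ξ, q.1 = u - ξ ∧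
        f u ≤ ((q.2.2 - lam' * N (u - q.2.1 - c) : ℝ) : EReal)} := by
  obtain ⟨r₀, hr₀⟩ : ∃ r : ℝ, f ξ₀ = r := ⟨_, (EReal.coe_toReal hfξ₀ (hf ξ₀)).symm⟩
  obtain ⟨C, hC, hCle⟩ := exists_norm_le_mul_seminorm N hN
  have hNcont := seminorm_continuous N
  intro hmem
  obtain ⟨q, hq, hlim⟩ := mem_closure_iff_seq_limit.1 hmem
  choose u ξ hξ hqu hfu using hq
  set K : ℝ := r₀ + s + lam' * N (ξ₀ - c) with hK
  -- `R` is so large that any `x` at distance `R` from `ξ₀` satisfies `K < (lam' - lam) * N (x -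
  -- c)`.
  set R : ℝ := ‖c - ξ₀‖ + C * (K / (lam' - lam)) + 1 with hR
  have hK0 : 0 ≤ K := by
    have := h ξ₀ hξ₀ r₀ hr₀.le
    nlinarith [apply_nonneg N (ξ₀ - c)]
  have hdpos : 0 < lam' - lam := sub_pos.2 hlt
  have hRpos : 0 < R := by positivity
  -- shrink the points towards `ξ₀` so that they stay in a ball of radius `R`
  have hshrink : ∀ n, ∃ t : ℝ, t ∈ Set.Icc (0 : ℝ) 1 ∧
      ξ₀ + t • (u n - ξ₀) ∈ Metric.closedBall ξ₀ R ∧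
      (1 - t) * (‖ξ₀ + t • (u n - ξ₀) - ξ₀‖ - R) = 0 := by
    intro n
    by_cases hn : ‖u n - ξ₀‖ ≤ R
    · exact ⟨1, by simp, by simpa [dist_eq_norm] using hn, by simp⟩
    · rw [not_le] at hn
      have hp : 0 < ‖u n - ξ₀‖ := hRpos.trans hn
      have heq : ‖(R / ‖u n - ξ₀‖) • (u n - ξ₀)‖ = R := by
        rw [norm_smul, Real.norm_of_nonneg (by positivity)]
        field_simp
      refine ⟨R / ‖u n - ξ₀‖, ⟨by positivity, (div_le_one hp).2 hn.le⟩, ?_, ?_⟩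
      · simp [dist_eq_norm, heq]
      · simp [heq]
  choose t ht hball hprod using hshrink
  obtain ⟨⟨x, T⟩, hxT, k, hk, hconvg⟩ :=
    ((isCompact_closedBall ξ₀ R).prod (isCompact_Icc (a := (0 : ℝ)) (b := 1))).tendsto_subseq
      (x := fun n => (ξ₀ + t n • (u n - ξ₀), t n)) fun n => ⟨hball n, ht n⟩
  have hx : Filter.Tendsto (fun n => ξ₀ + t (k n) • (u (k n) - ξ₀)) Filter.atTop (nhds x) :=
    (continuous_fst.tendsto _).comp hconvg
  have hT : Filter.Tendsto (fun n => t (k n)) Filter.atTop (nhds T) :=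
    (continuous_snd.tendsto _).comp hconvg
  have hT01 : T ∈ Set.Icc (0 : ℝ) 1 := hxT.2
  have hlim' := hlim.comp hk.tendsto_atTop
  have ha : Filter.Tendsto (fun n => (q (k n)).1) Filter.atTop (nhds 0) :=
    (continuous_fst.tendsto _).comp hlim'
  have hb : Filter.Tendsto (fun n => (q (k n)).2.1) Filter.atTop (nhds 0) :=
    (continuous_fst.tendsto _).comp ((continuous_snd.tendsto _).comp hlim')
  have hτ : Filter.Tendsto (fun n => (q (k n)).2.2) Filter.atTop (nhds (-s - δ)) :=
    (continuous_snd.tendsto _).comp ((continuous_snd.tendsto _).comp hlim')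
  have hxΞ : x ∈ Ξ := by
    have hy : Filter.Tendsto
        (fun n => ξ₀ + t (k n) • (u (k n) - ξ₀) - t (k n) • (q (k n)).1)
        Filter.atTop (nhds (x - T • 0)) := hx.sub (hT.smul ha)
    rw [smul_zero, sub_zero] at hy
    refine hΞ_closed.mem_of_tendsto hy (Filter.Eventually.of_forall fun n => ?_)
    have := hΞ_convex.add_smul_sub_mem hξ₀ (hξ (k n)) (ht (k n))
    convert this using 1
    rw [hqu (k n)]
    module
  set σ : ℕ → ℝ := fun n => (1 - t (k n)) * (r₀ + lam' * N (ξ₀ - c)) + t (k n) * (q (k n)).2.2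
    - lam' * N (ξ₀ + t (k n) • (u (k n) - ξ₀) - t (k n) • (q (k n)).2.1 - c) with hσ
  have hσlim : Filter.Tendsto σ Filter.atTop (nhds ((1 - T) * (r₀ + lam' * N (ξ₀ - c))
      + T * (-s - δ) - lam' * N (x - T • 0 - c))) :=
    (((tendsto_const_nhds.sub hT).mul_const _).add (hT.mul hτ)).sub
      (((hNcont.tendsto _).comp ((hx.sub (hT.smul hb)).sub_const c)).const_mul lam')
  rw [smul_zero, sub_zero] at hσlim
  -- Convexity on the segment from `ξ₀` to `u (k n)`, then closedness of the epigraph in the limit.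
  have hfx : f x ≤ (((1 - T) * (r₀ + lam' * N (ξ₀ - c))
      + T * (-s - δ) - lam' * N (x - c) : ℝ) : EReal) := by
    refine (isClosed_real_epigraph hlsc).mem_of_tendsto (hx.prodMk_nhds hσlim)
      (Filter.Eventually.of_forall fun n => ?_)
    obtain ⟨ht0, ht1⟩ := ht (k n)
    have hcomb : f (ξ₀ + t (k n) • (u (k n) - ξ₀)) ≤ (((1 - t (k n)) * r₀ + t (k n) *
        ((q (k n)).2.2 - lam' * N (u (k n) - (q (k n)).2.1 - c)) : ℝ) : EReal) := by
      have := hconv (x := (ξ₀, r₀)) hr₀.le (y := (u (k n), _)) (hfu (k n))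
        (sub_nonneg.2 ht1) ht0 (by ring)
      have hp : ξ₀ + t (k n) • (u (k n) - ξ₀) = (1 - t (k n)) • ξ₀ + t (k n) • u (k n) := by
        module
      rw [hp]
      simpa using this
    refine hcomb.trans (EReal.coe_le_coe_iff.2 ?_)
    have htri : N (ξ₀ + t (k n) • (u (k n) - ξ₀) - t (k n) • (q (k n)).2.1 - c) ≤
        (1 - t (k n)) * N (ξ₀ - c) + t (k n) * N (u (k n) - (q (k n)).2.1 - c) := by
      have : ξ₀ + t (k n) • (u (k n) - ξ₀) - t (k n) • (q (k n)).2.1 - c =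
          (1 - t (k n)) • (ξ₀ - c) + t (k n) • (u (k n) - (q (k n)).2.1 - c) := by module
      rw [this]
      refine (map_add_le_add N _ _).trans ?_
      rw [map_smul_eq_mul, map_smul_eq_mul, Real.norm_of_nonneg (sub_nonneg.2 ht1),
        Real.norm_of_nonneg ht0]
    have := mul_le_mul_of_nonneg_left htri (hlam.trans hlt.le)
    simp only [hσ]
    linarith
  have hlow := h x hxΞ _ hfx
  have hTprod : (1 - T) * (‖x - ξ₀‖ - R) = 0 := by
    refine tendsto_nhds_unique (f := fun n => (1 - t (k n)) *
      (‖ξ₀ + t (k n) • (u (k n) - ξ₀) - ξ₀‖ - R)) (l := Filter.atTop) ?_ ?_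
    · exact (tendsto_const_nhds.sub hT).mul (((hx.sub_const ξ₀).norm).sub_const R)
    · simp only [hprod]
      exact tendsto_const_nhds
  -- Either `T = 1`, and the inequality contradicts `0 < δ`, or `x` lies on the sphere of radius
  -- `R`, where the left side exceeds `K`.
  have hmain : (lam' - lam) * N (x - c) + T * δ ≤ (1 - T) * K := by
    rw [hK]; linarith
  have hNx := apply_nonneg N (x - c)
  rcases mul_eq_zero.1 hTprod with h1 | h1
  · have hT1 : T = 1 := by linarith
    subst hT1
    nlinarith
  · have hxc : R ≤ ‖c - ξ₀‖ + C * N (x - c) := by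
      have h2 : ‖x - ξ₀‖ ≤ ‖x - c‖ + ‖c - ξ₀‖ := norm_sub_le_norm_sub_add_norm_sub x c ξ₀
      linarith [hCle (x - c)]
    have h3 : K / (lam' - lam) < N (x - c) := by
      by_contra! hcon
      have := mul_le_mul_of_nonneg_left hcon hC.le
      linarith
    rw [div_lt_iff₀ hdpos] at h3
    nlinarith [hT01.1, hT01.2, mul_nonneg hT01.1 hδ.le, mul_nonneg hT01.1 hK0]

/-- The set is a projection: the witnesses `u` and `ξ` may be averaged along with `q`, since the
norm term is jointly convex in `u` and `q.2.1`. -/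
theorem convex_perturbation {M : ℕ} (N : Seminorm ℝ (Fin M → ℝ)) {f : (Fin M → ℝ) → EReal}
    (hconv : IsConvexFun f) {Ξ : Set (Fin M → ℝ)} (hΞ_convex : Convex ℝ Ξ) (c : Fin M → ℝ)
    {lam : ℝ} (hlam : 0 ≤ lam) :
    Convex ℝ {q : (Fin M → ℝ) × (Fin M → ℝ) × ℝ | ∃ u, ∃ ξ ∈ Ξ, q.1 = u - ξ ∧
        f u ≤ ((q.2.2 - lam * N (u - q.2.1 - c) : ℝ) : EReal)} := by
  rintro ⟨a, b, τ⟩ ⟨u, ξ, hξ, ha, hu⟩ ⟨a', b', τ'⟩ ⟨u', ξ', hξ', ha', hu'⟩ p r hp hr hpr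
  dsimp only at ha ha' hu hu'
  refine ⟨p • u + r • u', p • ξ + r • ξ', hΞ_convex hξ hξ' hp hr hpr, ?_, ?_⟩
  · simp only [Prod.smul_mk, Prod.mk_add_mk, ha, ha']
    module
  · have hcomb := hconv (x := (u, _)) hu (y := (u', _)) hu' hp hr hpr
    refine le_trans hcomb (EReal.coe_le_coe_iff.2 ?_)
    have htri : N (p • u + r • u' - (p • b + r • b') - c) ≤
        p * N (u - b - c) + r * N (u' - b' - c) := by
      have : p • u + r • u' - (p • b + r • b') - c =
          p • (u - b - c) + r • (u' - b' - c) := by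
        obtain rfl : p = 1 - r := by linarith
        module
      rw [this]
      refine (map_add_le_add N _ _).trans ?_
      rw [map_smul_eq_mul, map_smul_eq_mul, Real.norm_of_nonneg hp, Real.norm_of_nonneg hr]
    have := mul_le_mul_of_nonneg_left htri hlam
    simp only [Prod.smul_mk, Prod.mk_add_mk, smul_eq_mul]
    linarith

/-- Give the variable three copies: `u` in `f`, `ξ` in `Ξ` and `p` in the norm term. A hyperplane
separates the values at perturbations `(u - ξ, u - p)` from the level `-s - δ` at zero perturbation,
and its normalised slopes are the multipliers. The slack in `lam'` and `δ` stands in for a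
constraint qualification. -/
theorem exists_dual_certificate {M : ℕ} (N : Seminorm ℝ (Fin M → ℝ))
    (hN : ∀ u, N u = 0 → u = 0) {f : (Fin M → ℝ) → EReal} (hf : ∀ u, f u ≠ ⊥)
    (hconv : IsConvexFun f) (hlsc : LowerSemicontinuous f) {Ξ : Set (Fin M → ℝ)}
    (hΞ_convex : Convex ℝ Ξ) (hΞ_closed : IsClosed Ξ) {c ξ₀ : Fin M → ℝ} (hξ₀ : ξ₀ ∈ Ξ)
    (hfξ₀ : f ξ₀ ≠ ⊤) {s lam lam' δ : ℝ} (hlam : 0 ≤ lam) (hlt : lam < lam') (hδ : 0 < δ)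
    (h : ∀ ξ ∈ Ξ, ∀ ρ : ℝ, f ξ ≤ ρ → -s ≤ ρ + lam * N (ξ - c)) :
    ∃ z ν : Fin M → ℝ, (∀ u, z ⬝ᵥ u ≤ lam' * N u) ∧
      ∀ u (ρ : ℝ), f u ≤ ρ → ∀ ξ ∈ Ξ, (z - ν) ⬝ᵥ u - ρ + ν ⬝ᵥ ξ - z ⬝ᵥ c ≤ s + δ := by
  obtain ⟨r₀, hr₀⟩ : ∃ r : ℝ, f ξ₀ = r := ⟨_, (EReal.coe_toReal hfξ₀ (hf ξ₀)).symm⟩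
  obtain ⟨φ, k, hφ, hk⟩ := geometric_hahn_banach_point_closed
    (convex_perturbation N hconv hΞ_convex c (hlam.trans hlt.le)).closure isClosed_closure
    (not_mem_closure_perturbation N hN hf hconv hlsc hΞ_convex hΞ_closed hξ₀ hfξ₀ hlam hlt hδ h)
  obtain ⟨α, hα⟩ := exists_dotProduct_eq
    ((φ : ((Fin M → ℝ) × (Fin M → ℝ) × ℝ) →ₗ[ℝ] ℝ).comp
      (LinearMap.inl ℝ (Fin M → ℝ) ((Fin M → ℝ) × ℝ)))
  obtain ⟨β, hβ⟩ := exists_dotProduct_eq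
    ((φ : ((Fin M → ℝ) × (Fin M → ℝ) × ℝ) →ₗ[ℝ] ℝ).comp
      ((LinearMap.inr ℝ (Fin M → ℝ) ((Fin M → ℝ) × ℝ)).comp (LinearMap.inl ℝ (Fin M → ℝ) ℝ)))
  set γ := φ (0, 0, 1) with hγ
  have hsplit : ∀ a b r, φ (a, b, r) = α ⬝ᵥ a + β ⬝ᵥ b + r * γ := by
    intro a b r
    have h1 : φ (a, 0, 0) = α ⬝ᵥ a := hα a
    have h2 : φ (0, b, 0) = β ⬝ᵥ b := hβ b
    have h3 : φ (0, 0, r) = r * γ := by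
      rw [hγ, ← smul_eq_mul, ← map_smul]; simp
    rw [← h1, ← h2, ← h3, ← map_add, ← map_add]; simp
  have hlow : ∀ u (ρ : ℝ), f u ≤ ρ → ∀ ξ ∈ Ξ, ∀ p,
      (-s - δ) * γ < α ⬝ᵥ (u - ξ) + β ⬝ᵥ (u - p) + (ρ + lam' * N (p - c)) * γ := by
    intro u ρ hu ξ hξ p
    rw [← hsplit]
    have h1 := hk (u - ξ, u - p, ρ + lam' * N (p - c))
      (subset_closure ⟨u, ξ, hξ, rfl, by simpa using hu⟩)
    rw [hsplit, dotProduct_zero, dotProduct_zero] at hφ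
    linarith
  -- The hyperplane is not vertical: with all three copies equal to `ξ₀`, the set contains a point
  -- directly above `(0, 0, -s - δ)`.
  have hγpos : 0 < γ := by
    have h1 := hlow ξ₀ r₀ hr₀.le ξ₀ hξ₀ ξ₀
    have h2 := h ξ₀ hξ₀ r₀ hr₀.le
    simp only [sub_self, dotProduct_zero] at h1
    by_contra! hcon
    have h3 : 0 < r₀ + lam' * N (ξ₀ - c) + s + δ := by
      nlinarith [apply_nonneg N (ξ₀ - c)]
    nlinarith
  -- Fixing `u = ξ = ξ₀` and moving `p` freely bounds `z` up to a constant, which scaling removes.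
  -- Taking `p = c` kills the norm term and leaves the second inequality.
  refine ⟨γ⁻¹ • -β, γ⁻¹ • α, fun u => ?_, fun u ρ hu ξ hξ => ?_⟩
  · refine dotProduct_le_of_bounded N (C := (α ⬝ᵥ (ξ₀ - ξ₀) + β ⬝ᵥ (ξ₀ - c) + r₀ * γ
      + (s + δ) * γ) / γ) (fun v => ?_) u
    have h1 := hlow ξ₀ r₀ hr₀.le ξ₀ hξ₀ (c - v)
    have h2 : N (c - v - c) = N v := by
      rw [show c - v - c = -v by module, map_neg_eq_map]
    rw [h2] at h1
    rw [smul_dotProduct, smul_eq_mul, neg_dotProduct, inv_mul_eq_div, div_le_iff₀ hγpos,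
      add_mul, div_mul_cancel₀ _ hγpos.ne']
    simp only [dotProduct_sub] at h1 ⊢
    linarith
  · have h1 := hlow u ρ hu ξ hξ c
    rw [sub_self, map_zero, mul_zero, add_zero] at h1
    have h2 : (γ⁻¹ • -β - γ⁻¹ • α) ⬝ᵥ u - ρ + (γ⁻¹ • α) ⬝ᵥ ξ - (γ⁻¹ • -β) ⬝ᵥ c =
        (-(α ⬝ᵥ (u - ξ)) - β ⬝ᵥ (u - c) - ρ * γ) / γ := by
      simp only [sub_dotProduct, smul_dotProduct, neg_dotProduct, dotProduct_sub, smul_eq_mul]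
      field_simp
      ring
    rw [h2, div_le_iff₀ hγpos]
    linarith

/-! ### Attainment and Lagrangian duality in one multiplier -/

/-- The closed set where `g` reaches `a` stays at distance at least `d + η` from `c`, with `η > 0`.
There the excess distance is at least `η`, so a slope of `|D| / η` absorbs the constant `D` left by
the growth bound; elsewhere `a` itself is a bound. -/
theorem exists_slope_bound {M : ℕ} (N : Seminorm ℝ (Fin M → ℝ))
    (hN : ∀ u, N u = 0 → u = 0) {Ξ : Set (Fin M → ℝ)} (hΞ : IsClosed Ξ)
    {g : (Fin M → ℝ) → EReal} (husc : UpperSemicontinuous g) {A B : ℝ} (hB : 0 ≤ B)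
    (hgrow : ∀ ξ, g ξ ≤ ((A + B * N ξ : ℝ) : EReal)) {c : Fin M → ℝ} {d a : ℝ}
    (ha : ∀ ξ ∈ Ξ, N (ξ - c) ≤ d → g ξ < a) (hd : ∀ ξ ∈ Ξ, g ξ ≠ ⊥ → d ≤ N (ξ - c)) :
    ∃ K : ℝ, 0 ≤ K ∧ ∀ ξ ∈ Ξ, ∀ y : ℝ, (y : EReal) ≤ g ξ → y ≤ a + K * (N (ξ - c) - d) := by
  have hclosed : IsClosed (Ξ ∩ g ⁻¹' Set.Ici (a : EReal)) :=
    hΞ.inter (upperSemicontinuous_iff_isClosed_preimage.1 husc _)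
  have hbot : ∀ {ξ} {y : ℝ}, (y : EReal) ≤ g ξ → g ξ ≠ ⊥ := fun h hb =>
    EReal.coe_ne_bot _ (le_bot_iff.1 (hb ▸ h))
  rcases (Ξ ∩ g ⁻¹' Set.Ici (a : EReal)).eq_empty_or_nonempty with hZ | hZ
  · refine ⟨0, le_rfl, fun ξ hξ y hy => ?_⟩
    by_contra! hcon
    have : ξ ∈ Ξ ∩ g ⁻¹' Set.Ici (a : EReal) :=
      ⟨hξ, le_trans (EReal.coe_le_coe_iff.2 (by linarith)) hy⟩
    simp [hZ] at this
  · obtain ⟨x, hx, hmin⟩ := exists_isMinOn_seminorm_sub N hN c hclosed hZ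
    have hη : 0 < N (x - c) - d := by
      by_contra! hcon
      exact absurd (ha x hx.1 (by linarith)) (not_lt.2 hx.2)
    set η := N (x - c) - d with hηdef
    set D := A + B * (N c + d) - a with hD
    refine ⟨B + |D| / η, by positivity, fun ξ hξ y hy => ?_⟩
    have hge := hd ξ hξ (hbot hy)
    have hnn : 0 ≤ |D| / η := by positivity
    by_cases hya : a ≤ y
    · have h1 : y ≤ A + B * N ξ := EReal.coe_le_coe_iff.1 (hy.trans (hgrow ξ))
      have h2 : N ξ ≤ N (ξ - c) + N c := by simpa using map_add_le_add N (ξ - c) c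
      have h3 : η ≤ N (ξ - c) - d := by
        have := hmin ξ ⟨hξ, le_trans (EReal.coe_le_coe_iff.2 hya) hy⟩
        linarith
      have h4 : |D| ≤ |D| / η * (N (ξ - c) - d) := by
        calc |D| = |D| / η * η := by field_simp
          _ ≤ _ := by gcongr
      have h5 := le_abs_self D
      have h6 := mul_le_mul_of_nonneg_left h2 hB
      linarith
    · have : 0 ≤ (B + |D| / η) * (N (ξ - c) - d) :=
        mul_nonneg (by positivity) (by linarith)
      linarith

/-- Let `L` be the slopes `lam` for which a point of `T` left of the vertical axis lies above the
line of slope `lam` through the origin. At `sInf L` a point strictly above the line either already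
lies in the closed second quadrant or lies to the right of the axis. In the latter case it remains
above the line for a slightly larger slope in `L`, and the segment to a left-hand point for that
slope crosses the axis at nonnegative height. -/
theorem exists_convex_combination {T : Set (ℝ × ℝ)}
    (h : ∀ lam : ℝ, 0 ≤ lam → ∃ p ∈ T, lam * p.1 < p.2) (hneg : ∃ p ∈ T, p.1 < 0) :
    ∃ p ∈ T, ∃ q ∈ T, ∃ θ ∈ Set.Icc (0 : ℝ) 1,
      θ * p.1 + (1 - θ) * q.1 ≤ 0 ∧ 0 ≤ θ * p.2 + (1 - θ) * q.2 := by
  have hone : ∀ p ∈ T, p.1 ≤ 0 → 0 ≤ p.2 → ∃ p ∈ T, ∃ q ∈ T, ∃ θ ∈ Set.Icc (0 : ℝ) 1,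
      θ * p.1 + (1 - θ) * q.1 ≤ 0 ∧ 0 ≤ θ * p.2 + (1 - θ) * q.2 :=
    fun p hp h1 h2 => ⟨p, hp, p, hp, 1, by simp, by simpa using h1, by simpa using h2⟩
  set L : Set ℝ := {lam | 0 ≤ lam ∧ ∃ p ∈ T, p.1 < 0 ∧ lam * p.1 < p.2} with hL
  have hLne : L.Nonempty := by
    obtain ⟨p, hp, hp1⟩ := hneg
    refine ⟨max 0 (p.2 / p.1 + 1), le_max_left _ _, p, hp, hp1, ?_⟩
    have h1 : (p.2 / p.1 + 1) * p.1 < p.2 := by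
      rw [add_mul, div_mul_cancel₀ _ hp1.ne]
      linarith
    exact lt_of_le_of_lt (mul_le_mul_of_nonpos_right (le_max_right _ _) hp1.le) h1
  have hLbdd : BddBelow L := ⟨0, fun x hx => hx.1⟩
  have hmem0 : 0 ≤ sInf L := le_csInf hLne fun x hx => hx.1
  obtain ⟨p, hp, hlt⟩ := h (sInf L) hmem0
  rcases lt_trichotomy p.1 0 with hp1 | hp1 | hp1
  · rcases hmem0.eq_or_lt with h0 | h0
    · rw [← h0, zero_mul] at hlt
      exact hone p hp hp1.le hlt.le
    · exfalso
      have h1 : p.2 / p.1 < sInf L := (div_lt_iff_of_neg hp1).2 hlt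
      obtain ⟨m, hm1, hm2⟩ := exists_between (max_lt h0 h1)
      rw [max_lt_iff] at hm1
      refine absurd (csInf_le hLbdd (⟨hm1.1.le, p, hp, hp1, ?_⟩ : m ∈ L)) (not_le.2 hm2)
      exact (div_lt_iff_of_neg hp1).1 hm1.2
  · rw [hp1, mul_zero] at hlt
    exact hone p hp hp1.le hlt.le
  · have h1 : sInf L < p.2 / p.1 := (lt_div_iff₀ hp1).2 hlt
    obtain ⟨m, ⟨-, q, hq, hq1, hq2⟩, hm⟩ := exists_lt_of_csInf_lt hLne h1
    rw [lt_div_iff₀ hp1] at hm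
    have hpos : 0 < p.1 - q.1 := by linarith
    have hsum : 1 - -q.1 / (p.1 - q.1) = p.1 / (p.1 - q.1) := by
      field_simp
      ring
    -- This weight makes the first coordinate of the combination zero.
    refine ⟨p, hp, q, hq, -q.1 / (p.1 - q.1),
      ⟨div_nonneg (by linarith) hpos.le, (div_le_one hpos).2 (by linarith)⟩, ?_, ?_⟩
    · rw [hsum]
      apply le_of_eq
      field_simp
      ring
    · rw [hsum, div_mul_eq_mul_div, div_mul_eq_mul_div, ← add_div]
      refine div_nonneg ?_ hpos.le
      nlinarith

/-- If the Lagrangian bound exceeds `v` for every multiplier, then some two-point mixture of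
selections has cost at most `ε` and value at least `v`. -/
theorem exists_mixture_of_lagrangian {M : ℕ} (N : Seminorm ℝ (Fin M → ℝ))
    (hN : ∀ u, N u = 0 → u = 0) {Ξ : Set (Fin M → ℝ)} (hΞ : IsClosed Ξ)
    {g : (Fin M → ℝ) → EReal} (husc : UpperSemicontinuous g) {A B : ℝ} (hB : 0 ≤ B)
    (hgrow : ∀ ξ, g ξ ≤ ((A + B * N ξ : ℝ) : EReal))
    {ι : Type*} [Fintype ι] {w : ι → ℝ} (hw : ∀ r, 0 ≤ w r) (hw1 : ∑ r, w r = 1)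
    (c : ι → Fin M → ℝ) {ε v : ℝ}
    (h : ∀ lam : ℝ, 0 ≤ lam → ∃ (x : ι → Fin M → ℝ) (y : ι → ℝ),
      (∀ r, x r ∈ Ξ ∧ (y r : EReal) ≤ g (x r)) ∧
      v + lam * (∑ r, w r * N (x r - c r) - ε) < ∑ r, w r * y r) :
    ∃ (x x' : ι → Fin M → ℝ) (y y' : ι → ℝ), (∀ r, x r ∈ Ξ ∧ (y r : EReal) ≤ g (x r)) ∧
      (∀ r, x' r ∈ Ξ ∧ (y' r : EReal) ≤ g (x' r)) ∧ ∃ θ ∈ Set.Icc (0 : ℝ) 1,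
        θ * ∑ r, w r * N (x r - c r) + (1 - θ) * ∑ r, w r * N (x' r - c r) ≤ ε ∧
        v ≤ θ * ∑ r, w r * y r + (1 - θ) * ∑ r, w r * y' r := by
  by_cases hslater : ∃ (x : ι → Fin M → ℝ) (y : ι → ℝ),
      (∀ r, x r ∈ Ξ ∧ (y r : EReal) ≤ g (x r)) ∧ ∑ r, w r * N (x r - c r) < ε
  · set T : Set (ℝ × ℝ) := {p | ∃ (x : ι → Fin M → ℝ) (y : ι → ℝ),
      (∀ r, x r ∈ Ξ ∧ (y r : EReal) ≤ g (x r)) ∧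
      p.1 = ∑ r, w r * N (x r - c r) - ε ∧ p.2 = ∑ r, w r * y r - v} with hT
    have h1 : ∀ lam : ℝ, 0 ≤ lam → ∃ p ∈ T, lam * p.1 < p.2 := by
      intro lam hlam
      obtain ⟨x, y, hxy, hlt⟩ := h lam hlam
      exact ⟨(_, _), ⟨x, y, hxy, rfl, rfl⟩, by dsimp only; linarith⟩
    have h2 : ∃ p ∈ T, p.1 < 0 := by
      obtain ⟨x, y, hxy, hlt⟩ := hslater
      exact ⟨(_, _), ⟨x, y, hxy, rfl, rfl⟩, by dsimp only; linarith⟩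
    obtain ⟨p, ⟨x, y, hxy, hp1, hp2⟩, q, ⟨x', y', hxy', hq1, hq2⟩, θ, hθ, hc, hv⟩ :=
      exists_convex_combination h1 h2
    refine ⟨x, x', y, y', hxy, hxy', θ, hθ, ?_, ?_⟩
    · rw [hp1, hq1] at hc
      linarith
    · rw [hp2, hq2] at hv
      linarith
  -- Every selection costs at least `ε`. Below, `d r` is the distance from `c r` to the domain of
  -- `g` in `Ξ`, and `X r` maximises `g` among the points of `Ξ` within that distance; a single
  -- selection will suffice.
  · push Not at hslater
    have hbot : ∀ {ξ} {y : ℝ}, (y : EReal) ≤ g ξ → g ξ ≠ ⊥ := fun h hb =>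
      EReal.coe_ne_bot _ (le_bot_iff.1 (hb ▸ h))
    have htop : ∀ ξ, g ξ ≠ ⊤ := fun ξ => ne_top_of_le_ne_top (EReal.coe_ne_top _) (hgrow ξ)
    have hreal : ∀ {ξ}, g ξ ≠ ⊥ → ((g ξ).toReal : EReal) = g ξ := fun hξ =>
      EReal.coe_toReal (htop _) hξ
    obtain ⟨x₀, y₀, hxy₀, -⟩ := h 0 le_rfl
    have hι : Nonempty ι := by
      by_contra hcon
      rw [not_nonempty_iff] at hcon
      simp at hw1
    obtain ⟨r₁⟩ := hι
    set dom : Set (Fin M → ℝ) := {ξ | ξ ∈ Ξ ∧ g ξ ≠ ⊥} with hdom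
    have hdomne : dom.Nonempty := ⟨x₀ r₁, (hxy₀ r₁).1, hbot (hxy₀ r₁).2⟩
    set d : ι → ℝ := fun r => sInf ((fun ξ => N (ξ - c r)) '' dom) with hd
    have hbdd : ∀ r, BddBelow ((fun ξ => N (ξ - c r)) '' dom) := fun r =>
      ⟨0, by rintro _ ⟨ξ, -, rfl⟩; exact apply_nonneg N _⟩
    have hdle : ∀ r, ∀ ξ ∈ Ξ, g ξ ≠ ⊥ → d r ≤ N (ξ - c r) := fun r ξ hξ hg =>
      csInf_le (hbdd r) ⟨ξ, ⟨hξ, hg⟩, rfl⟩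
    have hεd : ε ≤ ∑ r, w r * d r := by
      refine le_of_forall_pos_le_add fun δ hδ => ?_
      have hex : ∀ r, ∃ ξ ∈ dom, N (ξ - c r) < d r + δ := fun r => by
        obtain ⟨_, ⟨ξ, hξ, rfl⟩, hlt⟩ := exists_lt_of_csInf_lt (hdomne.image _)
          (lt_add_of_pos_right (d r) hδ)
        exact ⟨ξ, hξ, hlt⟩
      choose x hx hlt using hex
      refine (hslater x (fun r => (g (x r)).toReal)
        fun r => ⟨(hx r).1, (hreal (hx r).2).le⟩).trans ?_
      calc ∑ r, w r * N (x r - c r) ≤ ∑ r, w r * (d r + δ) :=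
            Finset.sum_le_sum fun r _ => mul_le_mul_of_nonneg_left (hlt r).le (hw r)
        _ = _ := by simp only [mul_add, Finset.sum_add_distrib, ← Finset.sum_mul, hw1, one_mul]
    have hmax : ∀ r, ∃ ξ ∈ Ξ, N (ξ - c r) ≤ d r ∧
        ∀ ξ' ∈ Ξ, N (ξ' - c r) ≤ d r → g ξ' ≤ g ξ := by
      intro r
      obtain ⟨C, hC, hCle⟩ := exists_norm_le_mul_seminorm N hN
      have hcl : IsClosed (Ξ ∩ {ξ | N (ξ - c r) ≤ d r}) := hΞ.inter <|
        isClosed_le ((seminorm_continuous N).comp (continuous_id.sub continuous_const))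
          continuous_const
      have hcpt : IsCompact (Ξ ∩ {ξ | N (ξ - c r) ≤ d r}) := by
        refine (isCompact_closedBall (c r) (C * d r)).of_isClosed_subset hcl fun ξ hξ => ?_
        rw [Metric.mem_closedBall, dist_eq_norm]
        exact (hCle _).trans (mul_le_mul_of_nonneg_left hξ.2 hC.le)
      obtain ⟨m, hm, hmin⟩ := exists_isMinOn_seminorm_sub N hN (c r) hΞ ⟨_, (hxy₀ r₁).1⟩
      have hne : (Ξ ∩ {ξ | N (ξ - c r) ≤ d r}).Nonempty := by
        refine ⟨m, hm, show N (m - c r) ≤ d r from le_csInf (hdomne.image _) ?_⟩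
        rintro _ ⟨ξ, hξ, rfl⟩
        exact hmin ξ hξ.1
      obtain ⟨ξ, hξ, hξmax⟩ := UpperSemicontinuousOn.exists_isMaxOn hne hcpt
        (husc.upperSemicontinuousOn _)
      exact ⟨ξ, hξ.1, hξ.2, fun ξ' h1 h2 => hξmax ⟨h1, h2⟩⟩
    choose X hX hXd hXmax using hmax
    -- For `lam` above all slopes from `exists_slope_bound`, moving beyond distance `d r` does not
    -- pay. As `ε - ∑ r, w r * d r` is nonpositive, the last term can be dropped; letting `lam` grow
    -- shows that it vanishes.
    have hkey : ∀ b : ι → ℝ, (∀ r, g (X r) < b r) → ∀ lam₀ : ℝ, ∃ lam, lam₀ ≤ lam ∧ 0 ≤ lam ∧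
        v < ∑ r, w r * b r + lam * (ε - ∑ r, w r * d r) := by
      intro b hb lam₀
      have hK : ∀ r, ∃ K : ℝ, 0 ≤ K ∧ ∀ ξ ∈ Ξ, ∀ y : ℝ, (y : EReal) ≤ g ξ →
          y ≤ b r + K * (N (ξ - c r) - d r) := fun r =>
        exists_slope_bound N hN hΞ husc hB hgrow
          (fun ξ hξ hξd => (hXmax r ξ hξ hξd).trans_lt (hb r)) (hdle r)
      choose K hK0 hKle using hK
      have hsum : 0 ≤ ∑ r, K r := Finset.sum_nonneg fun r _ => hK0 r
      have hlam : 0 ≤ |lam₀| + ∑ r, K r := by positivity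
      refine ⟨|lam₀| + ∑ r, K r, ?_, hlam, ?_⟩
      · linarith [le_abs_self lam₀]
      · obtain ⟨x, y, hxy, hlt⟩ := h _ hlam
        set lam := |lam₀| + ∑ r, K r with hlamdef
        have hy : ∀ r, w r * y r ≤ w r * b r + lam * (w r * N (x r - c r)) -
            lam * (w r * d r) := by
          intro r
          have h1 := hKle r _ (hxy r).1 _ (hxy r).2
          have h2 := hdle r _ (hxy r).1 (hbot (hxy r).2)
          have h3 : K r ≤ lam := by
            have := Finset.single_le_sum (fun r _ => hK0 r) (Finset.mem_univ r)
            linarith [abs_nonneg lam₀]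
          have h4 : y r ≤ b r + lam * (N (x r - c r) - d r) :=
            h1.trans (by gcongr)
          calc w r * y r ≤ w r * (b r + lam * (N (x r - c r) - d r)) :=
                mul_le_mul_of_nonneg_left h4 (hw r)
            _ = _ := by ring
        have hsumle := Finset.sum_le_sum fun r (_ : r ∈ Finset.univ) => hy r
        rw [Finset.sum_sub_distrib, Finset.sum_add_distrib, ← Finset.mul_sum,
          ← Finset.mul_sum] at hsumle
        linarith
    have hkey' : ∀ b : ι → ℝ, (∀ r, g (X r) < b r) → v < ∑ r, w r * b r := by
      intro b hb
      obtain ⟨lam, -, h0, hlt⟩ := hkey b hb 0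
      nlinarith
    have hub : ∀ r, ∃ b : ℝ, g (X r) < b := fun r => by
      obtain ⟨b, hb, -⟩ := EReal.lt_iff_exists_real_btwn.1 (lt_top_iff_ne_top.2 (htop (X r)))
      exact ⟨b, hb⟩
    choose b₀ hb₀ using hub
    have hεd' : ∑ r, w r * d r ≤ ε := by
      by_contra! hcon
      have hp : 0 < ∑ r, w r * d r - ε := sub_pos.2 hcon
      obtain ⟨lam, hle, -, hlt⟩ := hkey b₀ hb₀ ((∑ r, w r * b₀ r - v) / (∑ r, w r * d r - ε))
      rw [div_le_iff₀ hp] at hle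
      linarith
    have hXbot : ∀ r, 0 < w r → g (X r) ≠ ⊥ := by
      intro r hr hbotr
      classical
      -- If `g (X r) = ⊥`, the bound at `r` may be lowered at will; this choice makes the weighted
      -- sum equal `v`, against the strict inequality.
      have h1 := hkey' (Function.update b₀ r (b₀ r - (∑ r, w r * b₀ r - v) / w r)) fun r' => by
        by_cases hrr : r' = r
        · subst hrr
          rw [Function.update_self, hbotr]
          exact EReal.bot_lt_coe _
        · rw [Function.update_of_ne hrr]
          exact hb₀ r'
      have h2 : ∑ r', w r' * Function.update b₀ r (b₀ r - (∑ r, w r * b₀ r - v) / w r) r' =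
          ∑ r', w r' * b₀ r' - ∑ r', if r' = r then (∑ r, w r * b₀ r - v) else 0 := by
        rw [← Finset.sum_sub_distrib]
        refine Finset.sum_congr rfl fun r' _ => ?_
        by_cases hrr : r' = r
        · subst hrr
          rw [Function.update_self, if_pos rfl]
          field_simp
        · rw [Function.update_of_ne hrr, if_neg hrr, sub_zero]
      rw [h2, Finset.sum_ite_eq' Finset.univ r, if_pos (Finset.mem_univ r)] at h1
      linarith
    classical
    -- Only atoms of zero weight can have `g (X r) = ⊥`; they are sent to any point of the domain.
    set x : ι → Fin M → ℝ := fun r => if g (X r) = ⊥ then x₀ r else X r with hx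
    have hxdom : ∀ r, x r ∈ Ξ ∧ g (x r) ≠ ⊥ := by
      intro r
      by_cases hr : g (X r) = ⊥
      · simp only [hx, if_pos hr]
        exact ⟨(hxy₀ r).1, hbot (hxy₀ r).2⟩
      · simp only [hx, if_neg hr]
        exact ⟨hX r, hr⟩
    have hxX : ∀ r, 0 < w r → x r = X r := fun r hr => by simp only [hx, if_neg (hXbot r hr)]
    have hsel : ∀ r, x r ∈ Ξ ∧ (((g (x r)).toReal : ℝ) : EReal) ≤ g (x r) := fun r =>
      ⟨(hxdom r).1, (hreal (hxdom r).2).le⟩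
    refine ⟨x, x, fun r => (g (x r)).toReal, fun r => (g (x r)).toReal, hsel, hsel, 1,
      by simp, ?_, ?_⟩
    · rw [one_mul, sub_self, zero_mul, add_zero]
      refine le_trans (Finset.sum_le_sum fun r _ => ?_) hεd'
      rcases (hw r).eq_or_lt with h0 | h0
      · simp [← h0]
      · rw [hxX r h0]
        exact mul_le_mul_of_nonneg_left (hXd r) (hw r)
    · rw [one_mul, sub_self, zero_mul, add_zero]
      refine le_of_forall_pos_le_add fun δ hδ => ?_
      have h1 := hkey' (fun r => if g (X r) = ⊥ then 0 else (g (x r)).toReal + δ) fun r => by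
        by_cases hr : g (X r) = ⊥
        · rw [if_pos hr, hr]
          exact EReal.bot_lt_coe _
        · rw [if_neg hr]
          simp only [hx, if_neg hr]
          conv_lhs => rw [← hreal hr]
          rw [EReal.coe_lt_coe_iff]
          linarith
      refine h1.le.trans (le_of_eq ?_)
      change _ = ∑ r, w r * (g (x r)).toReal + δ
      calc ∑ r, w r * (if g (X r) = ⊥ then 0 else (g (x r)).toReal + δ)
          = ∑ r, w r * ((g (x r)).toReal + δ) := by
            refine Finset.sum_congr rfl fun r _ => ?_
            rcases (hw r).eq_or_lt with h0 | h0
            · simp [← h0]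
            · rw [if_neg (hXbot r h0)]
        _ = ∑ r, w r * (g (x r)).toReal + δ := by
            simp only [mul_add, Finset.sum_add_distrib, ← Finset.sum_mul, hw1, one_mul]

/-! ### Finitely supported distributions and the Wasserstein ball -/

/-- The finitely supported measure with mass `w r` at `c r`. -/
noncomputable def discreteMeasure {α ι : Type*} [MeasurableSpace α] [Fintype ι] (w : ι → ℝ)
    (c : ι → α) : Measure α :=
  ∑ r, ENNReal.ofReal (w r) • Measure.dirac (c r)

theorem lintegral_discreteMeasure {α ι : Type*} [MeasurableSpace α] [MeasurableSingletonClass α]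
    [Fintype ι] (w : ι → ℝ) (c : ι → α) (f : α → ℝ≥0∞) :
    ∫⁻ a, f a ∂(discreteMeasure w c) = ∑ r, ENNReal.ofReal (w r) * f (c r) := by
  simp [discreteMeasure, lintegral_finsetSum_measure, lintegral_smul_measure]

theorem ofReal_max_zero (b : ℝ) : ENNReal.ofReal (max b 0) = ENNReal.ofReal b := by
  simp [ENNReal.ofReal_max]

theorem lintegral_discreteMeasure_ofReal {α ι : Type*} [MeasurableSpace α]
    [MeasurableSingletonClass α] [Fintype ι] {w : ι → ℝ} (hw : ∀ r, 0 ≤ w r) (c : ι → α)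
    (f : α → ℝ) :
    ∫⁻ a, ENNReal.ofReal (f a) ∂(discreteMeasure w c) =
      ENNReal.ofReal (∑ r, w r * max (f (c r)) 0) := by
  rw [lintegral_discreteMeasure, ENNReal.ofReal_sum_of_nonneg fun r _ =>
    mul_nonneg (hw r) (le_max_right _ _)]
  refine Finset.sum_congr rfl fun r _ => ?_
  rw [ENNReal.ofReal_mul (hw r), ofReal_max_zero]

theorem map_discreteMeasure {α β ι : Type*} [MeasurableSpace α] [MeasurableSpace β] [Fintype ι]
    (w : ι → ℝ) (c : ι → α) {f : α → β} (hf : Measurable f) :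
    (discreteMeasure w c).map f = discreteMeasure w (f ∘ c) := by
  ext s hs
  rw [Measure.map_apply hf hs]
  simp [discreteMeasure, Measure.dirac_apply', hs, hf hs, Set.indicator]
  rfl

theorem trustDist_eq_discreteMeasure {M H I : ℕ} (t : Fin H → ℝ)
    (ξhat : Fin H → Fin I → Fin M → ℝ) :
    trustDist t ξhat =
      discreteMeasure (fun r : Fin H × Fin I => t r.1 / (I : ℝ)) fun r => ξhat r.1 r.2 := by
  simp [trustDist, discreteMeasure, Fintype.sum_prod_type, Finset.smul_sum]

/-- Splitting every atom into shares `θ` and `1 - θ` lets a mixture of two selections be treated as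
one selection over `ι × Bool`. -/
theorem discreteMeasure_prod_bool {α ι : Type*} [MeasurableSpace α] [Fintype ι] {w : ι → ℝ}
    (hw : ∀ r, 0 ≤ w r) (c : ι → α) {θ : ℝ} (hθ : θ ∈ Set.Icc (0 : ℝ) 1) :
    discreteMeasure (fun r : ι × Bool => w r.1 * if r.2 then θ else 1 - θ) (fun r => c r.1) =
      discreteMeasure w c := by
  simp only [discreteMeasure, Fintype.sum_prod_type, Fintype.sum_bool]
  refine Finset.sum_congr rfl fun r _ => ?_
  rw [← add_smul, ← ENNReal.ofReal_add]
  · congr 2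
    simp
    ring
  · simpa using mul_nonneg (hw r) hθ.1
  · simpa using mul_nonneg (hw r) (sub_nonneg.2 hθ.2)

theorem discreteMeasure_mem_wassersteinBall {M : ℕ} (N : Seminorm ℝ (Fin M → ℝ))
    {Ξ : Set (Fin M → ℝ)} {ι : Type*} [Fintype ι] {w : ι → ℝ} (hw : ∀ r, 0 ≤ w r)
    (hw1 : ∑ r, w r = 1) (c : ι → Fin M → ℝ) {x : ι → Fin M → ℝ} (hx : ∀ r, x r ∈ Ξ) {ε : ℝ}
    (hcost : ∑ r, w r * N (x r - c r) ≤ ε) :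
    discreteMeasure w x ∈ wassersteinBall N Ξ (discreteMeasure w c) ε := by
  refine ⟨⟨?_⟩, ?_, ?_, ?_⟩
  · rw [← lintegral_one, lintegral_discreteMeasure]
    simp only [mul_one]
    rw [← ENNReal.ofReal_sum_of_nonneg fun r _ => hw r, hw1, ENNReal.ofReal_one]
  · simp [discreteMeasure, hx]
  · rw [lintegral_discreteMeasure_ofReal hw]
    exact ENNReal.ofReal_lt_top
  · refine (iInf₂_le (discreteMeasure w fun r => (x r, c r)) ⟨?_, ?_⟩).trans ?_
    · rw [lintegral_discreteMeasure_ofReal hw _ fun p : (Fin M → ℝ) × (Fin M → ℝ) =>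
        N (p.1 - p.2)]
      refine ENNReal.ofReal_le_ofReal (le_trans (le_of_eq ?_) hcost)
      simp
    · rw [map_discreteMeasure _ _ measurable_fst]
      rfl
    · rw [map_discreteMeasure _ _ measurable_snd]
      rfl

theorem le_expect_discreteMeasure {M : ℕ} {ι : Type*} [Fintype ι] {w : ι → ℝ}
    (hw : ∀ r, 0 ≤ w r) {x : ι → Fin M → ℝ} {y : ι → ℝ} {g : (Fin M → ℝ) → EReal}
    (hy : ∀ r, (y r : EReal) ≤ g (x r)) :
    ((∑ r, w r * y r : ℝ) : EReal) ≤ expect (discreteMeasure w x) g := by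
  have hpos : ENNReal.ofReal (∑ r, w r * max (y r) 0) ≤
      ∫⁻ ξ, (g ξ).toENNReal ∂(discreteMeasure w x) := by
    rw [lintegral_discreteMeasure, ENNReal.ofReal_sum_of_nonneg fun r _ =>
      mul_nonneg (hw r) (le_max_right _ _)]
    refine Finset.sum_le_sum fun r _ => ?_
    rw [ENNReal.ofReal_mul (hw r), ofReal_max_zero,
      ← EReal.real_coe_toENNReal]
    gcongr
    exact EReal.toENNReal_le_toENNReal (hy r)
  have hneg : ∫⁻ ξ, (-(g ξ)).toENNReal ∂(discreteMeasure w x) ≤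
      ENNReal.ofReal (∑ r, w r * max (-y r) 0) := by
    rw [lintegral_discreteMeasure, ENNReal.ofReal_sum_of_nonneg fun r _ =>
      mul_nonneg (hw r) (le_max_right _ _)]
    refine Finset.sum_le_sum fun r _ => ?_
    rw [ENNReal.ofReal_mul (hw r), ofReal_max_zero,
      ← EReal.real_coe_toENNReal (-y r), EReal.coe_neg]
    gcongr
    exact EReal.toENNReal_le_toENNReal (EReal.neg_le_neg_iff.2 (hy r))
  refine le_trans (le_of_eq ?_) (EReal.sub_le_sub (EReal.coe_ennreal_le_coe_ennreal_iff.2 hpos)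
    (EReal.coe_ennreal_le_coe_ennreal_iff.2 hneg))
  rw [EReal.coe_ennreal_ofReal, EReal.coe_ennreal_ofReal,
    max_eq_left (Finset.sum_nonneg fun r _ => mul_nonneg (hw r) (le_max_right _ _)),
    max_eq_left (Finset.sum_nonneg fun r _ => mul_nonneg (hw r) (le_max_right _ _)),
    ← EReal.coe_sub, ← Finset.sum_sub_distrib]
  congr 1
  refine Finset.sum_congr rfl fun r _ => ?_
  rcases le_total 0 (y r) with h | h
  · rw [max_eq_left h, max_eq_right (by linarith)]
    ring
  · rw [max_eq_right h, max_eq_left (by linarith)]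
    ring

theorem le_worstCase_of_mixture {M : ℕ} (N : Seminorm ℝ (Fin M → ℝ)) {Ξ : Set (Fin M → ℝ)}
    {g : (Fin M → ℝ) → EReal} {ι : Type*} [Fintype ι] {w : ι → ℝ} (hw : ∀ r, 0 ≤ w r)
    (hw1 : ∑ r, w r = 1) (c : ι → Fin M → ℝ) {ε v θ : ℝ} {x x' : ι → Fin M → ℝ} {y y' : ι → ℝ}
    (hx : ∀ r, x r ∈ Ξ ∧ (y r : EReal) ≤ g (x r))
    (hx' : ∀ r, x' r ∈ Ξ ∧ (y' r : EReal) ≤ g (x' r)) (hθ : θ ∈ Set.Icc (0 : ℝ) 1)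
    (hcost : θ * ∑ r, w r * N (x r - c r) + (1 - θ) * ∑ r, w r * N (x' r - c r) ≤ ε)
    (hval : v ≤ θ * ∑ r, w r * y r + (1 - θ) * ∑ r, w r * y' r) :
    (v : EReal) ≤ worstCase N Ξ (discreteMeasure w c) ε g := by
  set ω : ι × Bool → ℝ := fun r => w r.1 * if r.2 then θ else 1 - θ with hω
  have hω0 : ∀ r, 0 ≤ ω r := fun r => mul_nonneg (hw _) (by
    split_ifs
    · exact hθ.1
    · exact sub_nonneg.2 hθ.2)
  have hsum : ∀ a a' : ι → ℝ, ∑ r, ω r * (if r.2 then a r.1 else a' r.1) =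
      θ * ∑ r, w r * a r + (1 - θ) * ∑ r, w r * a' r := by
    intro a a'
    rw [Fintype.sum_prod_type, Finset.mul_sum, Finset.mul_sum, ← Finset.sum_add_distrib]
    refine Finset.sum_congr rfl fun r _ => ?_
    simp only [hω, Fintype.sum_bool, if_true, Bool.false_eq_true, if_false]
    ring
  have hω1 : ∑ r, ω r = 1 := by
    have := hsum (fun _ => 1) (fun _ => 1)
    simpa [hw1] using this
  set X : ι × Bool → Fin M → ℝ := fun r => if r.2 then x r.1 else x' r.1 with hX
  set Y : ι × Bool → ℝ := fun r => if r.2 then y r.1 else y' r.1 with hY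
  have hXY : ∀ r, X r ∈ Ξ ∧ (Y r : EReal) ≤ g (X r) := by
    rintro ⟨r, b⟩
    cases b
    · simpa [hX, hY] using hx' r
    · simpa [hX, hY] using hx r
  have hmem : discreteMeasure ω X ∈ wassersteinBall N Ξ (discreteMeasure w c) ε := by
    rw [← discreteMeasure_prod_bool hw c hθ]
    refine discreteMeasure_mem_wassersteinBall N hω0 hω1 (fun r => c r.1)
      (fun r => (hXY r).1) ?_
    rw [← hsum] at hcost
    refine le_trans (le_of_eq (Finset.sum_congr rfl fun r _ => ?_)) hcost
    rcases r with ⟨r, b⟩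
    cases b <;> simp [hX]
  rw [← hsum] at hval
  exact (EReal.coe_le_coe_iff.2 hval).trans <|
    (le_expect_discreteMeasure hω0 fun r => (hXY r).2).trans <|
      le_iSup₂ (f := fun Q (_ : Q ∈ wassersteinBall N Ξ (discreteMeasure w c) ε) => expect Q g)
        _ hmem

/-! ### Weak duality -/

/-- Sorting positive and negative parts onto opposite sides removes all subtraction, so the
inequality can be integrated even when some integrals are infinite. -/
theorem toENNReal_add_le_of_le {a : EReal} {S m : ℝ} (hm : 0 ≤ m)
    (h : a ≤ ((S + m : ℝ) : EReal)) :
    a.toENNReal + ENNReal.ofReal (-S) ≤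
      (-a).toENNReal + ENNReal.ofReal S + ENNReal.ofReal m := by
  induction a with
  | bot => simp
  | top => exact absurd (top_le_iff.1 h) (EReal.coe_ne_top _)
  | coe a =>
    rw [EReal.coe_le_coe_iff] at h
    rw [← EReal.coe_neg, EReal.real_coe_toENNReal, EReal.real_coe_toENNReal]
    rw [← ofReal_max_zero a, ← ofReal_max_zero (-S), ← ofReal_max_zero (-a), ← ofReal_max_zero S,
      ← ENNReal.ofReal_add (by positivity) (by positivity),
      ← ENNReal.ofReal_add (by positivity) (by positivity),
      ← ENNReal.ofReal_add (by positivity) hm]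
    refine ENNReal.ofReal_le_ofReal ?_
    rcases le_total 0 a with ha | ha <;> rcases le_total 0 S with hS | hS <;>
      simp only [max_eq_left, max_eq_right, ha, hS, neg_nonneg, neg_nonpos] <;> linarith

theorem coe_sub_coe_le_of_add_le {a b : ℝ≥0∞} {n p m : ℝ} (hn : 0 ≤ n) (hp : 0 ≤ p) (hm : 0 ≤ m)
    (h : a + ENNReal.ofReal n ≤ b + ENNReal.ofReal p + ENNReal.ofReal m) :
    (a : EReal) - (b : EReal) ≤ ((p - n + m : ℝ) : EReal) := by
  by_cases hb : b = ⊤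
  -- In `EReal` subtracting `⊤` always gives `⊥`, including `⊤ - ⊤`.
  · simp [hb]
  · have ha : a ≠ ⊤ := by
      refine ne_top_of_le_ne_top ?_ (le_self_add.trans h)
      simp [hb]
    lift a to NNReal using ha
    lift b to NNReal using hb
    rw [← ENNReal.ofReal_coe_nnreal, ← ENNReal.ofReal_coe_nnreal, ← ENNReal.ofReal_add (by simp) hn,
      ← ENNReal.ofReal_add (by simp) hp, ← ENNReal.ofReal_add (by positivity) hm,
      ENNReal.ofReal_le_ofReal_iff (by positivity)] at h
    have h1 : (((a : NNReal) : ℝ≥0∞) : EReal) = ((a : ℝ) : EReal) := rfl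
    have h2 : (((b : NNReal) : ℝ≥0∞) : EReal) = ((b : ℝ) : EReal) := rfl
    rw [h1, h2, ← EReal.coe_sub, EReal.coe_le_coe_iff]
    linarith

/-- With `S` the minimum of the cones `s r + lam * N (· - c r)`, the triangle inequality extends the
bound on `g` from atoms to all `ξ'`. A coupling can thus be integrated directly without
disintegrating over atoms, and `S (c r) ≤ s r` holds even when atoms coincide. -/
theorem expect_le_of_mem_wassersteinBall {M : ℕ} (N : Seminorm ℝ (Fin M → ℝ))
    {Ξ : Set (Fin M → ℝ)} {g : (Fin M → ℝ) → EReal} (hgm : Measurable g)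
    {ι : Type*} [Fintype ι] [Nonempty ι] {w : ι → ℝ} (hw : ∀ r, 0 ≤ w r) (c : ι → Fin M → ℝ)
    {ε lam : ℝ} (hε : 0 ≤ ε) (hlam : 0 ≤ lam) {s : ι → ℝ}
    (hg : ∀ r, ∀ ξ ∈ Ξ, g ξ ≤ ((s r + lam * N (ξ - c r) : ℝ) : EReal))
    {Q : Measure (Fin M → ℝ)} (hQ : Q ∈ wassersteinBall N Ξ (discreteMeasure w c) ε) :
    expect Q g ≤ ((lam * ε + ∑ r, w r * s r : ℝ) : EReal) := by
  obtain ⟨-, hΞ, -, hW⟩ := hQ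
  have hNcont := seminorm_continuous N
  -- a continuous majorant of the dual variables `s r`
  set S : (Fin M → ℝ) → ℝ :=
    fun ξ' => Finset.univ.inf' Finset.univ_nonempty fun r => s r + lam * N (ξ' - c r) with hS
  have hScont : Continuous S := Continuous.finset_inf'_apply _ fun r _ =>
    continuous_const.add (continuous_const.mul (hNcont.comp (continuous_id.sub continuous_const)))
  have hSle : ∀ r, S (c r) ≤ s r := fun r => by
    refine (Finset.inf'_le _ (Finset.mem_univ r)).trans ?_
    simp
  have hgS : ∀ ξ ∈ Ξ, ∀ ξ', g ξ ≤ ((S ξ' + lam * N (ξ - ξ') : ℝ) : EReal) := by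
    intro ξ hξ ξ'
    obtain ⟨r, -, hr⟩ := Finset.exists_mem_eq_inf' (Finset.univ_nonempty (α := ι))
      fun r => s r + lam * N (ξ' - c r)
    refine (hg r ξ hξ).trans (EReal.coe_le_coe_iff.2 ?_)
    have h1 : N (ξ - c r) ≤ N (ξ - ξ') + N (ξ' - c r) := by
      simpa using map_add_le_add N (ξ - ξ') (ξ' - c r)
    have h2 := mul_le_mul_of_nonneg_left h1 hlam
    simp only [hS, hr]
    linarith
  have hmain : ∀ δ : ℝ, 0 < δ →
      expect Q g ≤ ((lam * (ε + δ) + ∑ r, w r * s r : ℝ) : EReal) := by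
    intro δ hδ
    have hlt : wassersteinDist N (discreteMeasure w c) Q < ENNReal.ofReal (ε + δ) :=
      hW.trans_lt ((ENNReal.ofReal_lt_ofReal_iff (by linarith)).2 (by linarith))
    rw [wassersteinDist, iInf_lt_iff] at hlt
    obtain ⟨γ, hlt⟩ := hlt
    rw [iInf_lt_iff] at hlt
    obtain ⟨⟨hγ1, hγ2⟩, hlt⟩ := hlt
    have hcost : ∫⁻ p, ENNReal.ofReal (lam * N (p.1 - p.2)) ∂γ ≤
        ENNReal.ofReal (lam * (ε + δ)) := by
      simp_rw [ENNReal.ofReal_mul hlam]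
      rw [lintegral_const_mul' _ _ ENNReal.ofReal_ne_top]
      gcongr
    have hae : ∀ᵐ p ∂γ, p.1 ∈ Ξ := by
      have h1 : ∀ᵐ ξ ∂(γ.map Prod.fst), ξ ∈ Ξ := by
        rw [hγ1]
        exact hΞ
      exact ae_of_ae_map measurable_fst.aemeasurable h1
    have hpt : ∀ᵐ p ∂γ, (g p.1).toENNReal + ENNReal.ofReal (-S p.2) ≤
        (-(g p.1)).toENNReal + ENNReal.ofReal (S p.2) + ENNReal.ofReal (lam * N (p.1 - p.2)) := by
      filter_upwards [hae] with p hp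
      exact toENNReal_add_le_of_le (mul_nonneg hlam (apply_nonneg N _)) (hgS _ hp _)
    have hSm : Measurable fun p : (Fin M → ℝ) × (Fin M → ℝ) => ENNReal.ofReal (S p.2) :=
      (hScont.measurable.comp measurable_snd).ennreal_ofReal
    have hSm' : Measurable fun p : (Fin M → ℝ) × (Fin M → ℝ) => ENNReal.ofReal (-S p.2) :=
      (hScont.measurable.comp measurable_snd).neg.ennreal_ofReal
    have hgp : Measurable fun ξ => (g ξ).toENNReal := hgm.ereal_toENNReal
    have hgn : Measurable fun ξ => (-(g ξ)).toENNReal := hgm.neg.ereal_toENNReal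
    have hint := lintegral_mono_ae hpt
    have hcm : Measurable fun p : (Fin M → ℝ) × (Fin M → ℝ) =>
        ENNReal.ofReal (lam * N (p.1 - p.2)) :=
      (continuous_const.mul (hNcont.comp (continuous_fst.sub continuous_snd))).measurable
        |>.ennreal_ofReal
    rw [lintegral_add_right _ hSm', lintegral_add_right _ hcm, lintegral_add_right _ hSm,
      ← lintegral_map hgp measurable_fst, ← lintegral_map hgn measurable_fst,
      ← lintegral_map (f := fun ξ => ENNReal.ofReal (S ξ)) hScont.measurable.ennreal_ofReal
        measurable_snd,
      ← lintegral_map (f := fun ξ => ENNReal.ofReal (-S ξ))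
        hScont.measurable.neg.ennreal_ofReal measurable_snd, hγ1, hγ2,
      lintegral_discreteMeasure_ofReal hw, lintegral_discreteMeasure_ofReal hw] at hint
    have hnn : ∀ b : ι → ℝ, 0 ≤ ∑ r, w r * max (b r) 0 := fun b =>
      Finset.sum_nonneg fun r _ => mul_nonneg (hw r) (le_max_right _ _)
    refine (coe_sub_coe_le_of_add_le (hnn _) (hnn _) (by positivity)
      (hint.trans (add_le_add_right hcost _))).trans (EReal.coe_le_coe_iff.2 ?_)
    rw [← Finset.sum_sub_distrib, add_comm]
    gcongr with r
    rw [← mul_sub]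
    refine mul_le_mul_of_nonneg_left (le_trans (le_of_eq ?_) (hSle r)) (hw r)
    rcases le_total 0 (S (c r)) with h | h
    · rw [max_eq_left h, max_eq_right (by linarith)]
      ring
    · rw [max_eq_right h, max_eq_left (by linarith)]
      ring
  refine EReal.le_of_forall_lt_iff_le.1 fun z hz => ?_
  rw [EReal.coe_lt_coe_iff] at hz
  -- Dividing by `lam + 1` keeps `lam` times the extra cost within the gap, also when `lam = 0`.
  refine (hmain ((z - (lam * ε + ∑ r, w r * s r)) / (lam + 1))
    (div_pos (by linarith) (by linarith))).trans (EReal.coe_le_coe_iff.2 ?_)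
  have h1 : lam * ((z - (lam * ε + ∑ r, w r * s r)) / (lam + 1)) ≤
      z - (lam * ε + ∑ r, w r * s r) := by
    rw [mul_div_assoc', div_le_iff₀ (by linarith)]
    nlinarith
  linarith

/-! ### The finite convex program -/

theorem mem_feasible_iff {M H I J : ℕ} {N : Seminorm ℝ (Fin M → ℝ)}
    (hN : ∀ u, N u = 0 → u = 0) {Ξ : Set (Fin M → ℝ)} (hΞ : Ξ.Nonempty)
    {l : Fin J → (Fin M → ℝ) → EReal} (hl : ∀ j, IsProper fun ξ => -(l j ξ))
    {ξhat : Fin H → Fin I → Fin M → ℝ} {lam : ℝ} {s : Fin H → Fin I → ℝ}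
    {z ν : Fin H → Fin I → Fin J → Fin M → ℝ} :
    ((lam, s, z, ν) : DecVar M H I J) ∈ feasible N Ξ l ξhat ↔
      (∀ h i j, ∀ u (ρ : ℝ), -(l j u) ≤ ρ → ∀ ξ ∈ Ξ,
        (z h i j - ν h i j) ⬝ᵥ u - ρ + ν h i j ⬝ᵥ ξ - z h i j ⬝ᵥ ξhat h i ≤ s h i) ∧
      ∀ h i j, 0 ≤ lam ∧ ∀ u, z h i j ⬝ᵥ u ≤ lam * N u :=
  and_congr
    (forall_congr' fun _ => forall_congr' fun _ => forall_congr' fun j =>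
      conjugate_add_supportFun_sub_le_iff (hl j) hΞ _ _ _ _)
    (forall_congr' fun _ => forall_congr' fun _ => forall_congr' fun _ =>
      dualNorm_le_iff N hN _ _)

/-- By `mem_feasible_iff` the constraints are inequalities affine in the decision variables, for
fixed `u`, `ρ` and `ξ`. -/
theorem convex_feasible {M H I J : ℕ} {N : Seminorm ℝ (Fin M → ℝ)}
    (hN : ∀ u, N u = 0 → u = 0) {Ξ : Set (Fin M → ℝ)} (hΞ : Ξ.Nonempty)
    {l : Fin J → (Fin M → ℝ) → EReal} (hl : ∀ j, IsProper fun ξ => -(l j ξ))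
    (ξhat : Fin H → Fin I → Fin M → ℝ) :
    Convex ℝ (feasible N Ξ l ξhat : Set (DecVar M H I J)) := by
  rintro ⟨lam, s, z, ν⟩ hd ⟨lam', s', z', ν'⟩ hd' a b ha hb hab
  rw [mem_feasible_iff hN hΞ hl] at hd hd'
  refine (mem_feasible_iff hN hΞ hl (lam := a * lam + b * lam') (s := a • s + b • s')
    (z := a • z + b • z') (ν := a • ν + b • ν')).2 ⟨fun h i j u ρ hu ξ hξ => ?_,
    fun h i j => ⟨?_, fun u => ?_⟩⟩
  · have h1 := mul_le_mul_of_nonneg_left (hd.1 h i j u ρ hu ξ hξ) ha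
    have h2 := mul_le_mul_of_nonneg_left (hd'.1 h i j u ρ hu ξ hξ) hb
    have h3 : ρ = a * ρ + b * ρ := by rw [← add_mul, hab, one_mul]
    simp only [Pi.add_apply, Pi.smul_apply, add_dotProduct, sub_dotProduct, smul_dotProduct,
      smul_eq_mul] at h1 h2 ⊢
    linarith
  · exact add_nonneg (mul_nonneg ha (hd.2 h i j).1) (mul_nonneg hb (hd'.2 h i j).1)
  · have h1 := mul_le_mul_of_nonneg_left ((hd.2 h i j).2 u) ha
    have h2 := mul_le_mul_of_nonneg_left ((hd'.2 h i j).2 u) hb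
    simp only [Pi.add_apply, Pi.smul_apply, add_dotProduct, smul_dotProduct, smul_eq_mul]
    linarith

theorem convexOn_objective {M H I J : ℕ} (t : Fin H → ℝ) (ε : ℝ) {S : Set (DecVar M H I J)}
    (hS : Convex ℝ S) : ConvexOn ℝ S (objective t ε) := by
  refine ⟨hS, ?_⟩
  rintro ⟨lam, s, z, ν⟩ - ⟨lam', s', z', ν'⟩ - a b ha hb hab
  simp only [objective, Prod.smul_mk, Pi.add_apply, Pi.smul_apply, smul_eq_mul,
    mul_add, Finset.sum_add_distrib, Finset.mul_sum, add_mul]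
  refine le_of_eq ?_
  have h1 : ∀ (k : ℝ) (f : Fin H → Fin I → ℝ),
      ∑ h, ∑ i, t h / (I : ℝ) * (k * f h i) = ∑ h, ∑ i, k * (t h / (I : ℝ) * f h i) :=
    fun k f => Finset.sum_congr rfl fun h _ => Finset.sum_congr rfl fun i _ => by ring
  rw [h1, h1]
  ring

theorem objective_eq_sum_prod {M H I J : ℕ} (t : Fin H → ℝ) (ε lam : ℝ)
    (s : Fin H → Fin I → ℝ) (z ν : Fin H → Fin I → Fin J → Fin M → ℝ) :
    objective t ε ((lam, s, z, ν) : DecVar M H I J) =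
      lam * ε + ∑ r : Fin H × Fin I, t r.1 / (I : ℝ) * s r.1 r.2 := by
  simp [objective, Fintype.sum_prod_type]

/-! ### Regularity of the loss -/

theorem upperSemicontinuous_iSup_loss {M J : ℕ} {l : Fin J → (Fin M → ℝ) → EReal}
    (hJ : 0 < J) (hlsc : ∀ j, LowerSemicontinuous fun ξ => -(l j ξ)) :
    UpperSemicontinuous fun ξ => ⨆ j, l j ξ := by
  have : Nonempty (Fin J) := ⟨⟨0, hJ⟩⟩
  refine upperSemicontinuous_iff_isClosed_preimage.2 fun a => ?_
  have heq : (fun ξ => ⨆ j, l j ξ) ⁻¹' Set.Ici a =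
      ⋃ j, (fun ξ => -(l j ξ)) ⁻¹' Set.Iic (-a) := by
    ext ξ
    simp only [Set.mem_preimage, Set.mem_Ici, Set.mem_iUnion, Set.mem_Iic, EReal.neg_le_neg_iff]
    constructor
    · intro h
      obtain ⟨j, hj⟩ := exists_eq_ciSup_of_finite (f := fun j => l j ξ)
      exact ⟨j, by rwa [hj]⟩
    · rintro ⟨j, hj⟩
      exact hj.trans (le_iSup (fun j => l j ξ) j)
  rw [heq]
  exact isClosed_iUnion_of_finite fun j =>
    lowerSemicontinuous_iff_isClosed_preimage.1 (hlsc j) _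

theorem exists_growth_bound {M J : ℕ} {N : Seminorm ℝ (Fin M → ℝ)}
    (hN : ∀ u, N u = 0 → u = 0) {l : Fin J → (Fin M → ℝ) → EReal}
    (hproper : ∀ j, IsProper fun ξ => -(l j ξ)) (hconv : ∀ j, IsConvexFun fun ξ => -(l j ξ))
    (hlsc : ∀ j, LowerSemicontinuous fun ξ => -(l j ξ)) :
    ∃ A B : ℝ, 0 ≤ B ∧ ∀ ξ, (⨆ j, l j ξ) ≤ ((A + B * N ξ : ℝ) : EReal) := by
  choose A B hB hle using fun j =>
    exists_affine_lower_bound N hN (hproper j) (hconv j) (hlsc j)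
  refine ⟨∑ j, |A j|, ∑ j, B j, Finset.sum_nonneg fun j _ => hB j, fun ξ => iSup_le fun j => ?_⟩
  have h1 : l j ξ ≤ ((A j + B j * N ξ : ℝ) : EReal) := by
    have := EReal.neg_le_neg_iff.2 (hle j ξ)
    rw [neg_neg, ← EReal.coe_neg] at this
    refine this.trans (EReal.coe_le_coe_iff.2 ?_)
    linarith
  refine h1.trans (EReal.coe_le_coe_iff.2 ?_)
  have h2 : A j ≤ ∑ j, |A j| := (le_abs_self _).trans
    (Finset.single_le_sum (f := fun j => |A j|) (fun j _ => abs_nonneg _) (Finset.mem_univ j))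
  have h3 : B j ≤ ∑ j, B j := Finset.single_le_sum (fun j _ => hB j) (Finset.mem_univ j)
  have h4 := mul_le_mul_of_nonneg_right h3 (apply_nonneg N ξ)
  linarith

/-! ### Duality -/

/-- Evaluating conjugate and support function at the same `ξ` cancels `ν`; the dual norm bound
handles the remaining `z ⬝ᵥ (ξ - ξhat h i)`. -/
theorem loss_le_of_mem_feasible {M H I J : ℕ} {N : Seminorm ℝ (Fin M → ℝ)}
    (hN : ∀ u, N u = 0 → u = 0) {Ξ : Set (Fin M → ℝ)} {l : Fin J → (Fin M → ℝ) → EReal}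
    (hl : ∀ j, IsProper fun ξ => -(l j ξ)) {ξhat : Fin H → Fin I → Fin M → ℝ} {lam : ℝ}
    {s : Fin H → Fin I → ℝ} {z ν : Fin H → Fin I → Fin J → Fin M → ℝ}
    (hd : ((lam, s, z, ν) : DecVar M H I J) ∈ feasible N Ξ l ξhat) (h : Fin H) (i : Fin I)
    {ξ : Fin M → ℝ} (hξ : ξ ∈ Ξ) :
    (⨆ j, l j ξ) ≤ ((s h i + lam * N (ξ - ξhat h i) : ℝ) : EReal) := by
  rw [mem_feasible_iff hN ⟨ξ, hξ⟩ hl] at hd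
  refine iSup_le fun j => ?_
  by_cases hbot : l j ξ = ⊥
  · simp [hbot]
  have htop : l j ξ ≠ ⊤ := fun ht => (hl j).1 ξ (by simp [ht])
  obtain ⟨y, hy⟩ : ∃ y : ℝ, l j ξ = y := ⟨_, (EReal.coe_toReal htop hbot).symm⟩
  rw [hy, EReal.coe_le_coe_iff]
  have h1 := hd.1 h i j ξ (-y) (by rw [hy, EReal.coe_neg]) ξ hξ
  have h2 := (hd.2 h i j).2 (-(ξ - ξhat h i))
  rw [map_neg_eq_map, dotProduct_neg, dotProduct_sub] at h2
  rw [sub_dotProduct] at h1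
  linarith

/-- For fixed `lam` the Lagrangian separates over atoms, so the optimal `s r` is the supremum of the
penalised loss at atom `r`. Fenchel certificates then make it feasible up to `δ`. -/
theorem optValue_le_of_lagrangian_le {M H I J : ℕ} {N : Seminorm ℝ (Fin M → ℝ)}
    (hN : ∀ u, N u = 0 → u = 0) {Ξ : Set (Fin M → ℝ)} (hΞ_convex : Convex ℝ Ξ)
    (hΞ_closed : IsClosed Ξ) {l : Fin J → (Fin M → ℝ) → EReal} (hJ : 0 < J)
    (hproper : ∀ j, IsProper fun ξ => -(l j ξ)) (hconv : ∀ j, IsConvexFun fun ξ => -(l j ξ))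
    (hlsc : ∀ j, LowerSemicontinuous fun ξ => -(l j ξ))
    (hbot : ∀ j, ∃ ξ ∈ Ξ, l j ξ ≠ ⊥) {t : Fin H → ℝ}
    (hw : ∀ r : Fin H × Fin I, 0 ≤ t r.1 / (I : ℝ))
    (hw1 : ∑ r : Fin H × Fin I, t r.1 / (I : ℝ) = 1)
    (ξhat : Fin H → Fin I → Fin M → ℝ) {ε : ℝ} (hε : 0 ≤ ε) {v lam : ℝ} (hlam : 0 ≤ lam)
    (h : ∀ (x : Fin H × Fin I → Fin M → ℝ) (y : Fin H × Fin I → ℝ),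
      (∀ r, x r ∈ Ξ ∧ (y r : EReal) ≤ ⨆ j, l j (x r)) →
      ∑ r, t r.1 / (I : ℝ) * y r ≤
        v + lam * (∑ r, t r.1 / (I : ℝ) * N (x r - ξhat r.1 r.2) - ε)) :
    optValue N Ξ l t ξhat ε ≤ (v : EReal) := by
  set w : Fin H × Fin I → ℝ := fun r => t r.1 / (I : ℝ) with hwdef
  set c : Fin H × Fin I → Fin M → ℝ := fun r => ξhat r.1 r.2 with hc
  choose ξb hξb hlb using hbot
  have htop : ∀ j ξ, l j ξ ≠ ⊤ := fun j ξ ht => (hproper j).1 ξ (by simp [ht])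
  set V : Fin H × Fin I → Set ℝ := fun r =>
    {b | ∃ ξ ∈ Ξ, ∃ y : ℝ, (y : EReal) ≤ (⨆ j, l j ξ) ∧ b = y - lam * N (ξ - c r)} with hV
  have hVne : ∀ r, (V r).Nonempty := fun r => by
    refine ⟨_, ξb ⟨0, hJ⟩, hξb _, (l ⟨0, hJ⟩ (ξb ⟨0, hJ⟩)).toReal, ?_, rfl⟩
    rw [EReal.coe_toReal (htop _ _) (hlb _)]
    exact le_iSup (fun j => l j (ξb ⟨0, hJ⟩)) ⟨0, hJ⟩
  -- A constant selection gives the bound even at atoms of zero weight, where `h` says nothing about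
  -- `x r` alone.
  have hVbdd : ∀ r, BddAbove (V r) := by
    refine fun r => ⟨v - lam * ε + lam * ∑ r', w r' * N (c r - c r'), ?_⟩
    rintro _ ⟨ξ, hξ, y, hy, rfl⟩
    have h1 := h (fun _ => ξ) (fun _ => y) fun _ => ⟨hξ, hy⟩
    rw [← Finset.sum_mul, hw1, one_mul] at h1
    have h2 : ∑ r', w r' * N (ξ - c r') ≤ N (ξ - c r) + ∑ r', w r' * N (c r - c r') := by
      calc ∑ r', w r' * N (ξ - c r')
          ≤ ∑ r', (w r' * N (ξ - c r) + w r' * N (c r - c r')) := by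
            refine Finset.sum_le_sum fun r' _ => ?_
            rw [← mul_add]
            refine mul_le_mul_of_nonneg_left ?_ (hw r')
            simpa using map_add_le_add N (ξ - c r) (c r - c r')
        _ = _ := by rw [Finset.sum_add_distrib, ← Finset.sum_mul, hw1, one_mul]
    have h3 := mul_le_mul_of_nonneg_left h2 hlam
    linarith
  set s : Fin H × Fin I → ℝ := fun r => sSup (V r) with hs
  have hsum : lam * ε + ∑ r, w r * s r ≤ v := by
    refine le_of_forall_pos_le_add fun δ hδ => ?_
    have hex : ∀ r, ∃ ξ, ∃ y : ℝ, (ξ ∈ Ξ ∧ (y : EReal) ≤ ⨆ j, l j ξ) ∧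
        s r - δ < y - lam * N (ξ - c r) := fun r => by
      obtain ⟨_, ⟨ξ, hξ, y, hy, rfl⟩, hlt⟩ :=
        exists_lt_of_lt_csSup (hVne r) (sub_lt_self (s r) hδ)
      exact ⟨ξ, y, ⟨hξ, hy⟩, hlt⟩
    choose x y hxy hlt using hex
    have h1 := h x y hxy
    have h2 : ∑ r, w r * (s r - δ) ≤ ∑ r, (w r * y r - lam * (w r * N (x r - c r))) :=
      Finset.sum_le_sum fun r _ => by
        calc w r * (s r - δ) ≤ w r * (y r - lam * N (x r - c r)) :=
              mul_le_mul_of_nonneg_left (hlt r).le (hw r)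
          _ = _ := by ring
    rw [Finset.sum_sub_distrib, ← Finset.mul_sum] at h2
    simp only [mul_sub, Finset.sum_sub_distrib] at h2
    rw [← Finset.sum_mul, hw1, one_mul] at h2
    linarith
  have hcert : ∀ δ : ℝ, 0 < δ → ∀ (p : Fin H) (i : Fin I) (j : Fin J), ∃ z ν : Fin M → ℝ,
      (∀ u, z ⬝ᵥ u ≤ (lam + δ) * N u) ∧ ∀ u (ρ : ℝ), -(l j u) ≤ ρ → ∀ ξ ∈ Ξ,
        (z - ν) ⬝ᵥ u - ρ + ν ⬝ᵥ ξ - z ⬝ᵥ ξhat p i ≤ s (p, i) + δ := by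
    intro δ hδ p i j
    refine exists_dual_certificate N hN (hproper j).1 (hconv j) (hlsc j) hΞ_convex hΞ_closed
      (hξb j) (by simpa using hlb j) hlam (lt_add_of_pos_right lam hδ) hδ fun ξ hξ ρ hρ => ?_
    have h1 : ((-ρ : ℝ) : EReal) ≤ ⨆ j, l j ξ := by
      refine le_trans ?_ (le_iSup (fun j => l j ξ) j)
      rw [EReal.coe_neg]
      exact EReal.neg_le_of_neg_le hρ
    have h2 : -ρ - lam * N (ξ - ξhat p i) ≤ s (p, i) :=
      le_csSup (hVbdd (p, i)) ⟨ξ, hξ, -ρ, h1, rfl⟩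
    linarith
  refine EReal.le_of_forall_lt_iff_le.1 fun b hb => ?_
  rw [EReal.coe_lt_coe_iff] at hb
  have hδ : 0 < (b - v) / (ε + 1) := div_pos (by linarith) (by linarith)
  -- Raising `lam` and every `s r` by `δ` raises the objective by `δ * (ε + 1) = b - v`.
  set δ := (b - v) / (ε + 1) with hδdef
  choose z ν hz hzν using hcert δ hδ
  have hmem : ((lam + δ, fun p i => s (p, i) + δ, z, ν) : DecVar M H I J) ∈
      feasible N Ξ l ξhat :=
    (mem_feasible_iff hN ⟨_, hξb ⟨0, hJ⟩⟩ hproper).2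
      ⟨fun p i j => hzν p i j, fun p i j => ⟨by positivity, hz p i j⟩⟩
  refine (iInf₂_le _ hmem).trans (EReal.coe_le_coe_iff.2 ?_)
  rw [objective_eq_sum_prod]
  have h1 : ∑ r : Fin H × Fin I, t r.1 / (I : ℝ) * (s (r.1, r.2) + δ) =
      ∑ r, w r * s r + δ := by
    simp only [mul_add, Finset.sum_add_distrib]
    rw [← Finset.sum_mul, hw1, one_mul]
  have h2 : δ * (ε + 1) = b - v := div_mul_cancel₀ _ (by linarith)
  rw [h1]
  linarith

end MRDRO

/-! ### Convex reduction of the worst-case expectation -/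

theorem mainTheorem1 {K M H I J : ℕ} (hI : 0 < I) (hJ : 0 < J)
    -- an arbitrary norm on `ℝ^M`: a seminorm that vanishes only at `0`
    (N : Seminorm ℝ (Fin M → ℝ)) (hN : ∀ u, N u = 0 → u = 0)
    (X : Set (Fin K → ℝ)) (Ξ : Set (Fin M → ℝ))
    (l : Fin J → (Fin K → ℝ) → (Fin M → ℝ) → EReal)
    (hΞ_convex : Convex ℝ Ξ) (hΞ_closed : IsClosed Ξ)
    (h_proper : ∀ x ∈ X, ∀ j, MRDRO.IsProper (fun ξ => -(l j x ξ)))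
    (h_convex : ∀ x ∈ X, ∀ j, MRDRO.IsConvexFun (fun ξ => -(l j x ξ)))
    (h_lsc : ∀ x ∈ X, ∀ j, LowerSemicontinuous (fun ξ => -(l j x ξ)))
    (h_not_bot : ∀ x ∈ X, ∀ j, ∃ ξ ∈ Ξ, l j x ξ ≠ ⊥)
    (t : Fin H → ℝ) (ht_nonneg : ∀ h, 0 ≤ t h) (ht_sum : ∑ h, t h = 1)
    (ξhat : Fin H → Fin I → Fin M → ℝ) (ε : ℝ) (hε : 0 ≤ ε) :
    ∀ x ∈ X,
      MRDRO.worstCase N Ξ (MRDRO.trustDist t ξhat) ε (fun ξ => ⨆ j, l j x ξ) =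
        MRDRO.optValue N Ξ (fun j => l j x) t ξhat ε ∧
      ConvexOn ℝ (MRDRO.feasible (H := H) (I := I) N Ξ (fun j => l j x) ξhat)
        (MRDRO.objective t ε) := by
  intro x hx
  have hw : ∀ r : Fin H × Fin I, 0 ≤ t r.1 / (I : ℝ) := fun r =>
    div_nonneg (ht_nonneg _) (Nat.cast_nonneg I)
  have hI' : (I : ℝ) ≠ 0 := Nat.cast_ne_zero.2 hI.ne'
  have hw1 : ∑ r : Fin H × Fin I, t r.1 / (I : ℝ) = 1 := by
    rw [Fintype.sum_prod_type, ← ht_sum]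
    refine Finset.sum_congr rfl fun h _ => ?_
    simp only [Finset.sum_const, Finset.card_univ, Fintype.card_fin, nsmul_eq_mul]
    field_simp
  have hH : 0 < H := by
    rcases Nat.eq_zero_or_pos H with rfl | h
    · simp at ht_sum
    · exact h
  have hne : Nonempty (Fin H × Fin I) := ⟨(⟨0, hH⟩, ⟨0, hI⟩)⟩
  obtain ⟨ξ₀, hξ₀, -⟩ := h_not_bot x hx ⟨0, hJ⟩
  have husc := MRDRO.upperSemicontinuous_iSup_loss hJ (h_lsc x hx)
  obtain ⟨A, B, hB, hgrow⟩ :=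
    MRDRO.exists_growth_bound hN (h_proper x hx) (h_convex x hx) (h_lsc x hx)
  refine ⟨le_antisymm ?_ ?_, MRDRO.convexOn_objective t ε
    (MRDRO.convex_feasible hN ⟨ξ₀, hξ₀⟩ (h_proper x hx) ξhat)⟩
  · rw [MRDRO.trustDist_eq_discreteMeasure]
    refine iSup₂_le fun Q hQ => le_iInf₂ ?_
    rintro ⟨lam, s, z, ν⟩ hd
    have hlam : 0 ≤ lam :=
      (((MRDRO.mem_feasible_iff hN ⟨ξ₀, hξ₀⟩ (h_proper x hx)).1 hd).2
        ⟨0, hH⟩ ⟨0, hI⟩ ⟨0, hJ⟩).1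
    rw [MRDRO.objective_eq_sum_prod]
    exact MRDRO.expect_le_of_mem_wassersteinBall N husc.measurable hw _ hε hlam
      (s := fun r => s r.1 r.2)
      (fun r ξ hξ => MRDRO.loss_le_of_mem_feasible hN (h_proper x hx) hd r.1 r.2 hξ) hQ
  · rw [MRDRO.trustDist_eq_discreteMeasure]
    refine EReal.ge_of_forall_gt_iff_ge.1 fun v hv => ?_
    obtain ⟨y, y', b, b', hy, hy', θ, hθ, hcost, hval⟩ :=
      MRDRO.exists_mixture_of_lagrangian N hN hΞ_closed husc hB hgrow hw hw1
        (fun r => ξhat r.1 r.2) (ε := ε) (v := v) fun lam hlam => by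
          by_contra! hcon
          exact absurd (MRDRO.optValue_le_of_lagrangian_le hN hΞ_convex hΞ_closed hJ
            (h_proper x hx) (h_convex x hx) (h_lsc x hx) (h_not_bot x hx) hw hw1 ξhat hε hlam
            hcon) (not_le.2 hv)
    exact MRDRO.le_worstCase_of_mixture N hw hw1 _ hy hy' hθ hcost hval
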